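/- Let $\mathbb R_+=\,]0,\infty[$ and $L^2=L^2(\mathbb R_+)$ (complex-valued functions). For $m\in\mathbb C$ let $\tilde L_m=-\partial_x^2+(m^2-\tfrac14)x^{-2}$, acting on distributions on $\mathbb R_+$. Let $L_m^{\max}$ be the restriction of $\tilde L_m$ to $\mathcal D(L_m^{\max})=\{f\in L^2 : \tilde L_m f\in L^2\}$, regarded as an operator in $L^2$, and let $L_m^{\min}$ be the closure of the restriction of $L_m^{\max}$ to $C_c^\infty(\mathbb R_+)$. A strict extension of $L_m^{\min}$ is an operator $S$ with $L_m^{\min}\subsetneq S\subsetneq L_m^{\max}$. Let $(U_\tau f)(x)=e^{\tau/2}f(e^\tau x)$, $\tau\in\mathbb R$, be the unitary dilation group on $L^2$; an operator $S$ is called homogeneous (of degree $-2$) if $U_\tau S U_\tau^{-1}=e^{-2\tau}S$ for all $\tau\in\mathbb R$. Fix any $\xi\in C^\infty(\mathbb R_+)$ with $\xi=1$ on $]0,1]$ and $\xi=0$ on $[2,\infty[$, and put $\zeta_m(x)=x^{1/2+m}$. For $\operatorname{Re} m>-1$ let $H_m$ be the restriction of $L_m^{\max}$ to $\mathcal D(L_m^{\min})+\mathbb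 C\,\xi\zeta_m$. If $|\operatorname{Re} m|<1$ and $m\neq0$, then $L_m^{\min}$ has exactly two homogeneous strict extensions, namely $H_m$ and $H_{-m}$, and these are distinct. For $m=0$, the operator $H_0$ is the unique homogeneous strict extension of $L_0^{\min}$. -/

import Mathlib

open Set MeasureTheory Distributions
open scoped ContDiff ENNReal

noncomputable section

/-! ### The Hilbert space `L²(ℝ₊)` and test functions on `ℝ₊ = ]0, ∞[` -/

/-- Lebesgue measure on `ℝ₊ = ]0, ∞[`. -/
abbrev halfLineMeasure : Measure ℝ := volume.restrict (Ioi (0 : ℝ))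

/-- The Hilbert space `L² = L²(ℝ₊)`, `ℝ₊ = ]0, ∞[`, of complex-valued functions. -/
abbrev L2HalfLine : Type := Lp ℂ 2 halfLineMeasure

/-- `ℝ₊ = ]0, ∞[` as an open set. -/
def halfLine : TopologicalSpace.Opens ℝ := ⟨Ioi (0 : ℝ), isOpen_Ioi⟩

/-- The differential expression `-φ'' + (m² - 1/4) x⁻² φ` on a smooth function. -/
def formalL (m : ℂ) (φ : ℝ → ℂ) (x : ℝ) : ℂ :=
  -deriv (deriv φ) x + (m ^ 2 - 1 / 4) / (x : ℂ) ^ 2 * φ x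

/-- `g = (-∂ₓ² + (m² - 1/4) x⁻²) f` in the sense of distributions on `ℝ₊`. -/
def IsDistribL (m : ℂ) (f g : L2HalfLine) : Prop :=
  ∀ φ : 𝓓(halfLine, ℂ),
    ∫ x in Ioi (0 : ℝ), f x * formalL m φ x = ∫ x in Ioi (0 : ℝ), g x * φ x

theorem formalL_memLp (m : ℂ) (φ : 𝓓(halfLine, ℂ)) :
    MemLp (formalL m φ) 2 halfLineMeasure := by
  have hsm : ContDiff ℝ ∞ φ := φ.contDiff
  have hcs : HasCompactSupport φ := φ.hasCompactSupport
  have hd2 : Continuous (deriv (deriv φ)) := by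
    have h := hsm.continuous_iteratedDeriv 2 ENat.LEInfty.out
    rwa [iteratedDeriv_succ, iteratedDeriv_one] at h
  have h0 : (0 : ℝ) ∉ tsupport φ := fun h => lt_irrefl (0 : ℝ) (φ.tsupport_subset h)
  have hc : Continuous fun x : ℝ => (m ^ 2 - 1 / 4) / (x : ℂ) ^ 2 * φ x := by
    rw [continuous_iff_continuousAt]
    intro x
    by_cases hx : x = 0
    · subst hx
      have : (fun x : ℝ => (m ^ 2 - 1 / 4) / (x : ℂ) ^ 2 * φ x) =ᶠ[nhds 0] fun _ => (0 : ℂ) := by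
        filter_upwards [notMem_tsupport_iff_eventuallyEq.mp h0] with y hy
        simp [hy]
      exact continuousAt_const.congr this.symm
    · have hx' : (x : ℂ) ^ 2 ≠ 0 := by simpa using hx
      exact (continuousAt_const.div (Complex.continuous_ofReal.pow 2).continuousAt hx').mul
        φ.continuous.continuousAt
  have hcont : Continuous (formalL m φ) := hd2.neg.add hc
  have hsupp : HasCompactSupport (formalL m φ) :=
    (hcs.deriv.deriv.neg).add hcs.mul_left
  exact hcont.memLp_of_hasCompactSupport hsupp

theorem testFunction_memLp (φ : 𝓓(halfLine, ℂ)) : MemLp φ 2 halfLineMeasure :=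
  φ.continuous.memLp_of_hasCompactSupport φ.hasCompactSupport

theorem L2HalfLine_integrable_mul (f : L2HalfLine) {ψ : ℝ → ℂ} (hψ : MemLp ψ 2 halfLineMeasure) :
    Integrable (fun x => f x * ψ x) halfLineMeasure :=
  (Lp.memLp f).integrable_mul hψ

theorem L2HalfLine_integral_add (f g : L2HalfLine) {ψ : ℝ → ℂ}
    (hψ : MemLp ψ 2 halfLineMeasure) :
    ∫ x in Ioi (0 : ℝ), (f + g) x * ψ x =
      (∫ x in Ioi (0 : ℝ), f x * ψ x) + ∫ x in Ioi (0 : ℝ), g x * ψ x := by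
  rw [← integral_add (L2HalfLine_integrable_mul f hψ) (L2HalfLine_integrable_mul g hψ)]
  refine integral_congr_ae ?_
  filter_upwards [Lp.coeFn_add f g] with x hx
  rw [hx, Pi.add_apply, add_mul]

theorem L2HalfLine_integral_smul (c : ℂ) (f : L2HalfLine) (ψ : ℝ → ℂ) :
    ∫ x in Ioi (0 : ℝ), (c • f) x * ψ x = c * ∫ x in Ioi (0 : ℝ), f x * ψ x := by
  rw [← integral_const_mul]
  refine integral_congr_ae ?_
  filter_upwards [Lp.coeFn_smul c f] with x hx
  rw [hx, Pi.smul_apply, smul_eq_mul, mul_assoc]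

/-! ### The maximal and the minimal operator -/

/-- The graph `{(f, g) ∈ L² × L² | L̃_m f = g}` of the maximal operator. -/
def maxGraph (m : ℂ) : Submodule ℂ (L2HalfLine × L2HalfLine) where
  carrier := {p | IsDistribL m p.1 p.2}
  zero_mem' := by
    intro φ
    have h := L2HalfLine_integral_smul 0 0 (formalL m φ)
    have h' := L2HalfLine_integral_smul 0 0 φ
    rw [zero_smul, zero_mul] at h h'
    exact h.trans h'.symm
  add_mem' := by
    intro p q hp hq φ
    have e := congrArg₂ (· + ·) (hp φ) (hq φ)
    simpa only [Prod.fst_add, Prod.snd_add,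
      L2HalfLine_integral_add _ _ (formalL_memLp m φ),
      L2HalfLine_integral_add _ _ (testFunction_memLp φ)] using e
  smul_mem' := by
    intro c p hp φ
    simp only [Prod.smul_fst, Prod.smul_snd, L2HalfLine_integral_smul]
    rw [hp φ]

/-- The maximal operator `L_m^max`: the restriction of `L̃_m` to `{f ∈ L² | L̃_m f ∈ L²}`. -/
def Lmax (m : ℂ) : L2HalfLine →ₗ.[ℂ] L2HalfLine := (maxGraph m).toLinearPMap

/-- A distribution is represented by at most one element of `L²`, so `maxGraph` is the graph of an
operator. -/
theorem maxGraph_functional (m : ℂ) :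
    ∀ p ∈ maxGraph m, p.1 = 0 → p.2 = 0 := by
  rintro ⟨f, g⟩ hp (rfl : f = 0)
  have hz : ∀ φ : 𝓓(halfLine, ℂ), ∫ x in Ioi (0 : ℝ), g x * φ x = 0 := by
    intro φ
    have h := L2HalfLine_integral_smul 0 0 (formalL m φ)
    rw [zero_smul, zero_mul] at h
    exact (hp φ).symm.trans h
  have hloc : LocallyIntegrableOn g (Ioi (0 : ℝ)) volume :=
    locallyIntegrableOn_of_locallyIntegrable_restrict ((Lp.memLp g).locallyIntegrable (by norm_num))
  have key := isOpen_Ioi.ae_eq_zero_of_integral_contDiff_smul_eq_zero hloc (by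
    intro η hη hηc hηs
    let φ : 𝓓(halfLine, ℂ) :=
      ⟨fun x => (η x : ℂ), Complex.ofRealCLM.contDiff.comp hη,
        hηc.comp_left (g := fun y : ℝ => (y : ℂ)) Complex.ofReal_zero,
        (tsupport_comp_subset (g := fun y : ℝ => (y : ℂ)) Complex.ofReal_zero η).trans hηs⟩
    have h := hz φ
    rw [← setIntegral_eq_integral_of_forall_compl_eq_zero (s := Ioi (0 : ℝ))]
    · rw [← h]
      refine integral_congr_ae (Filter.Eventually.of_forall fun x => ?_)
      change η x • g x = g x * (η x : ℂ)
      rw [Complex.real_smul, mul_comm]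
    · intro x hx
      rw [image_eq_zero_of_notMem_tsupport (fun h' => hx (hηs h')), zero_smul])
  change g = 0
  rw [Lp.eq_zero_iff_ae_eq_zero]
  exact (ae_restrict_iff' measurableSet_Ioi).mpr key

theorem Lmax_graph (m : ℂ) : (Lmax m).graph = maxGraph m :=
  Submodule.toLinearPMap_graph_eq _ (fun x hx hx' => maxGraph_functional m x hx hx')

/-- `C_c^∞(ℝ₊)` as a subspace of `L²`. -/
def smoothCompact : Submodule ℂ L2HalfLine where
  carrier := {f | ∃ φ : 𝓓(halfLine, ℂ), f =ᵐ[halfLineMeasure] φ}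
  zero_mem' := ⟨0, Lp.coeFn_zero _ _ _⟩
  add_mem' := by
    rintro f g ⟨φ, hφ⟩ ⟨ψ, hψ⟩
    refine ⟨φ + ψ, (Lp.coeFn_add f g).trans ?_⟩
    exact hφ.add hψ
  smul_mem' := by
    rintro c f ⟨φ, hφ⟩
    refine ⟨c • φ, (Lp.coeFn_smul c f).trans ?_⟩
    exact hφ.const_smul c

/-- The minimal operator `L_m^min`: the closure of the restriction of `L_m^max` to
`C_c^∞(ℝ₊)`. -/
def Lmin (m : ℂ) : L2HalfLine →ₗ.[ℂ] L2HalfLine := ((Lmax m).domRestrict smoothCompact).closure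

theorem continuous_L2HalfLine_integral {ψ : ℝ → ℂ} (hψ : MemLp ψ 2 halfLineMeasure) :
    Continuous fun f : L2HalfLine => ∫ x in Ioi (0 : ℝ), f x * ψ x := by
  have hs : MemLp (fun x => star (ψ x)) 2 halfLineMeasure := hψ.star
  have h : Continuous fun f : L2HalfLine => inner ℂ (hs.toLp _) f := by fun_prop
  refine h.congr fun f => ?_
  rw [L2.inner_def]
  refine integral_congr_ae ?_
  filter_upwards [hs.coeFn_toLp] with x hx
  rw [hx]
  simp

/-- The maximal operator is closed; hence the closure defining `Lmin` is a genuine one. -/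
theorem Lmax_isClosed (m : ℂ) : (Lmax m).IsClosed := by
  rw [LinearPMap.IsClosed, Lmax_graph]
  have : ((maxGraph m : Submodule ℂ (L2HalfLine × L2HalfLine)) : Set (L2HalfLine × L2HalfLine)) =
      ⋂ φ : 𝓓(halfLine, ℂ), {p | ∫ x in Ioi (0 : ℝ), p.1 x * formalL m φ x =
        ∫ x in Ioi (0 : ℝ), p.2 x * φ x} := by
    ext p
    simp only [mem_iInter]
    rfl
  rw [this]
  exact isClosed_iInter fun φ => isClosed_eq
    ((continuous_L2HalfLine_integral (formalL_memLp m φ)).comp continuous_fst)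
    ((continuous_L2HalfLine_integral (testFunction_memLp φ)).comp continuous_snd)

theorem Lmax_restrict_isClosable (m : ℂ) : ((Lmax m).domRestrict smoothCompact).IsClosable :=
  (Lmax_isClosed m).isClosable.leIsClosable LinearPMap.domRestrict_le

/-- A strict extension of `L_m^min`: an operator `S` with `L_m^min ⊊ S ⊊ L_m^max`. -/
def IsStrictExtension (m : ℂ) (S : L2HalfLine →ₗ.[ℂ] L2HalfLine) : Prop :=
  Lmin m < S ∧ S < Lmax m

/-! ### The operators `H_m` -/

/-- The solution `ζ_m(x) = x^{1/2 + m}` of `L̃_m u = 0` on `ℝ₊` (for `m = 0` this is `√x`). -/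
def zetaFun (m : ℂ) (x : ℝ) : ℂ := (x : ℂ) ^ (1 / 2 + m)

/-- `ξ ∈ C^∞(ℝ₊)` with `ξ = 1` on `]0, 1]` and `ξ = 0` on `[2, ∞[`. -/
structure IsCutoff (ξ : ℝ → ℂ) : Prop where
  smooth : ContDiffOn ℝ ∞ ξ (Ioi 0)
  eq_one : ∀ x ∈ Ioc (0 : ℝ) 1, ξ x = 1
  eq_zero : ∀ x ∈ Ici (2 : ℝ), ξ x = 0

/-- The subspace `ℂ ξ ζ_m` of `L²` (`ξ ζ_m` is square integrable when `Re m > -1`). -/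
def cutoffLine (ξ : ℝ → ℂ) (m : ℂ) : Submodule ℂ L2HalfLine where
  carrier := {f | ∃ c : ℂ, f =ᵐ[halfLineMeasure] fun x => c * (ξ x * zetaFun m x)}
  zero_mem' := ⟨0, by
    filter_upwards [Lp.coeFn_zero ℂ 2 halfLineMeasure] with x hx
    rw [hx]; simp⟩
  add_mem' := by
    rintro f g ⟨c, hc⟩ ⟨d, hd⟩
    refine ⟨c + d, ?_⟩
    filter_upwards [Lp.coeFn_add f g, hc, hd] with x hx h1 h2
    rw [hx, Pi.add_apply, h1, h2, add_mul]
  smul_mem' := by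
    rintro a f ⟨c, hc⟩
    refine ⟨a * c, ?_⟩
    filter_upwards [Lp.coeFn_smul a f, hc] with x hx h1
    rw [hx, Pi.smul_apply, h1, smul_eq_mul, mul_assoc]

/-- The operator `H_m`, for `Re m > -1`: the restriction of `L_m^max` to
`D(L_m^min) + ℂ ξ ζ_m`. -/
def Hop (ξ : ℝ → ℂ) (m : ℂ) : L2HalfLine →ₗ.[ℂ] L2HalfLine :=
  (Lmax m).domRestrict ((Lmin m).domain ⊔ cutoffLine ξ m)

/-! ### The dilation group and homogeneous operators -/

theorem map_mul_halfLineMeasure (τ : ℝ) :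
    Measure.map (fun x => Real.exp τ * x) halfLineMeasure =
      ENNReal.ofReal (Real.exp (-τ)) • halfLineMeasure := by
  have he : MeasurableEmbedding (fun x : ℝ => Real.exp τ * x) :=
    (Homeomorph.mulLeft₀ (Real.exp τ) (Real.exp_ne_zero τ)).measurableEmbedding
  have hpre : (fun x : ℝ => Real.exp τ * x) ⁻¹' Ioi 0 = Ioi 0 := by
    ext x
    simp [Real.exp_pos]
  have h := he.restrict_map volume (Ioi (0 : ℝ))
  rw [hpre, Real.map_volume_mul_left (Real.exp_ne_zero τ), ← Real.exp_neg,
    abs_of_pos (Real.exp_pos _), Measure.restrict_smul] at h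
  exact h.symm

theorem quasiMeasurePreserving_mul (τ : ℝ) :
    Measure.QuasiMeasurePreserving (fun x => Real.exp τ * x) halfLineMeasure halfLineMeasure := by
  refine ⟨by fun_prop, ?_⟩
  rw [map_mul_halfLineMeasure]
  exact Measure.smul_absolutelyContinuous

theorem eLpNorm_dilation (τ : ℝ) (f : L2HalfLine) :
    eLpNorm (fun x => ((Real.exp (τ / 2) : ℝ) : ℂ) * f (Real.exp τ * x)) 2 halfLineMeasure =
      eLpNorm f 2 halfLineMeasure := by
  have h1 : eLpNorm (fun x => f (Real.exp τ * x)) 2 halfLineMeasure =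
      ENNReal.ofReal (Real.exp (-τ / 2)) * eLpNorm f 2 halfLineMeasure := by
    have h2 := eLpNorm_map_measure (p := 2) (f := fun x : ℝ => Real.exp τ * x) (g := f)
      (μ := halfLineMeasure)
      ((Lp.aestronglyMeasurable f).mono_ac (quasiMeasurePreserving_mul τ).absolutelyContinuous)
      (by fun_prop)
    rw [map_mul_halfLineMeasure, eLpNorm_smul_measure_of_ne_top (by norm_num), smul_eq_mul] at h2
    rw [show (fun x => f (Real.exp τ * x)) = f ∘ fun x => Real.exp τ * x from rfl, ← h2]
    congr 1
    rw [ENNReal.ofReal_rpow_of_pos (Real.exp_pos _), ← Real.exp_mul]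
    congr 2
    simp
    ring
  have h3 := eLpNorm_const_smul ((Real.exp (τ / 2) : ℝ) : ℂ) (fun x => f (Real.exp τ * x)) 2
    halfLineMeasure
  change eLpNorm (((Real.exp (τ / 2) : ℝ) : ℂ) • fun x => f (Real.exp τ * x)) 2 _ = _
  rw [h3, h1, ← mul_assoc, ← ofReal_norm, Complex.norm_real,
    Real.norm_of_nonneg (Real.exp_pos _).le, ← ENNReal.ofReal_mul (Real.exp_pos _).le,
    ← Real.exp_add]
  simp [neg_div]

theorem memLp_dilation (τ : ℝ) (f : L2HalfLine) :
    MemLp (fun x => ((Real.exp (τ / 2) : ℝ) : ℂ) * f (Real.exp τ * x)) 2 halfLineMeasure := by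
  refine ⟨?_, by rw [eLpNorm_dilation]; exact (Lp.memLp f).2⟩
  exact ((Lp.aestronglyMeasurable f).comp_quasiMeasurePreserving
    (quasiMeasurePreserving_mul τ)).const_mul _

/-- `(U_τ f)(x) = e^{τ/2} f(e^τ x)`. -/
def dilationFun (τ : ℝ) (f : L2HalfLine) : L2HalfLine := (memLp_dilation τ f).toLp _

theorem coeFn_dilationFun (τ : ℝ) (f : L2HalfLine) :
    dilationFun τ f =ᵐ[halfLineMeasure]
      fun x => ((Real.exp (τ / 2) : ℝ) : ℂ) * f (Real.exp τ * x) :=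
  (memLp_dilation τ f).coeFn_toLp

theorem dilationFun_neg (τ : ℝ) (f : L2HalfLine) : dilationFun (-τ) (dilationFun τ f) = f := by
  apply Lp.ext
  filter_upwards [coeFn_dilationFun (-τ) (dilationFun τ f),
    (quasiMeasurePreserving_mul (-τ)).ae_eq_comp (coeFn_dilationFun τ f)] with x h1 h2
  simp only [Function.comp_apply] at h2
  rw [h1, h2, ← mul_assoc, ← mul_assoc, ← Complex.ofReal_mul, ← Real.exp_add, ← Real.exp_add]
  simp [neg_div]

/-- The unitary dilation group on `L²`: `(U_τ f)(x) = e^{τ/2} f(e^τ x)`. -/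
def dilation (τ : ℝ) : L2HalfLine ≃ₗᵢ[ℂ] L2HalfLine where
  toFun := dilationFun τ
  invFun := dilationFun (-τ)
  left_inv := dilationFun_neg τ
  right_inv f := by simpa using dilationFun_neg (-τ) f
  map_add' f g := by
    apply Lp.ext
    filter_upwards [coeFn_dilationFun τ (f + g), coeFn_dilationFun τ f, coeFn_dilationFun τ g,
      Lp.coeFn_add (dilationFun τ f) (dilationFun τ g),
      (quasiMeasurePreserving_mul τ).ae_eq_comp (Lp.coeFn_add f g)] with x h1 h2 h3 h4 h5
    simp only [Function.comp_apply, Pi.add_apply] at h5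
    rw [h1, h4, Pi.add_apply, h2, h3, h5, mul_add]
  map_smul' c f := by
    apply Lp.ext
    filter_upwards [coeFn_dilationFun τ (c • f), coeFn_dilationFun τ f,
      Lp.coeFn_smul c (dilationFun τ f),
      (quasiMeasurePreserving_mul τ).ae_eq_comp (Lp.coeFn_smul c f)] with x h1 h2 h3 h4
    simp only [Function.comp_apply, Pi.smul_apply, smul_eq_mul] at h4
    rw [h1, RingHom.id_apply, h3, Pi.smul_apply, h2, h4, smul_eq_mul]
    ring
  norm_map' f := by
    change ‖dilationFun τ f‖ = ‖f‖
    rw [Lp.norm_def, Lp.norm_def, eLpNorm_congr_ae (coeFn_dilationFun τ f), eLpNorm_dilation]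

/-- An operator `S` is homogeneous of degree `ν` (with respect to the dilation group) if
`U_τ S U_τ⁻¹ = e^{ντ} S` for all real `τ`: the domain is stable under the group and
`U_τ S U_τ⁻¹ f = e^{ντ} S f` for all `f` in the domain. -/
def IsHomogeneousOp (ν : ℝ) (S : L2HalfLine →ₗ.[ℂ] L2HalfLine) : Prop :=
  ∀ (τ : ℝ) (f : S.domain), ∃ h : (dilation τ).symm (f : L2HalfLine) ∈ S.domain,
    dilation τ (S ⟨(dilation τ).symm (f : L2HalfLine), h⟩) = ((Real.exp (ν * τ) : ℝ) : ℂ) • S f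

end

/-!
The theorem reduces to linear algebra in a two-dimensional space of boundary values at `0`.

Let `p`, `q` be solutions of `L̃_m u = 0` with Wronskian `p q' - p' q = 1`; for `|Re m| < 1` both
are square integrable near `0`. Every element `f` of the maximal domain, with `L̃_m f = g`, is
`f = A p + B q` with `A' = q g` and `B' = -p g` (`FundamentalSystem.exists_hasBoundaryValues`): the
variation-of-constants solution differs from `f` by a functional on test functions that vanishes
on `L̃_m ψ`, hence on all test functions orthogonal to `p` and `q`, hence by a combination of `p`
and `q`. Since `p g` and `q g` are integrable near `0`, the coefficients have limits `a`, `b` at `0`,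
the boundary values of `f`.

The Wronskian of two elements `f₁`, `f₂` of the maximal domain is `A₁ B₂ - A₂ B₁`. Its limit at
infinity is zero, so Green's identity reads
`∫ (g₁ f₂ - f₁ g₂) = a₂ b₁ - a₁ b₂` (`FundamentalSystem.HasBoundaryValues.greenForm_eq`). The graph
of the minimal operator is the annihilator of the graph of the maximal one under this form
(`mem_graph_Lmin_iff`), because the maximal graph is by definition the annihilator of the graph
over the test functions. As the cutoff functions `ξ (a p + b q)` realize all boundary values, the
minimal domain is the kernel of the boundary map from the maximal domain onto `ℂ × ℂ`, and strict
extensions are the restrictions of the maximal operator to lines of boundary values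
(`FundamentalSystem.isStrictExtension_iff`).

Dilations act on boundary values through their action on `p` and `q`, and an extension is
homogeneous exactly if its line is invariant
(`FundamentalSystem.isHomogeneousOp_restriction_iff`). For `m ≠ 0` one takes `p = ζ_m` and
`q = -ζ_{-m} / (2 m)`, on which dilations act diagonally with distinct eigenvalues: there are two
invariant lines, belonging to `H_m` and `H_{-m}`. For `m = 0` one takes `p = √x` and
`q = √x log x`, on which dilations act by Jordan blocks: there is one invariant line, that of `H_0`.
-/

noncomputable section

/-! ### Primitives of locally integrable functions -/

/-- `F` is a primitive of `f` on `s`: `f` is integrable between any two points of `s`, and the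
increments of `F` are the integrals of `f`. -/
structure PrimitiveOn (s : Set ℝ) (F f : ℝ → ℂ) : Prop where
  integrable : ∀ x ∈ s, ∀ y ∈ s, IntervalIntegrable f volume x y
  eq : ∀ x ∈ s, ∀ y ∈ s, F y - F x = ∫ t in x..y, f t

namespace PrimitiveOn

variable {s t : Set ℝ} {F G f g : ℝ → ℂ}

theorem mono (h : PrimitiveOn s F f) (hts : t ⊆ s) : PrimitiveOn t F f :=
  ⟨fun x hx y hy => h.integrable x (hts hx) y (hts hy),
    fun x hx y hy => h.eq x (hts hx) y (hts hy)⟩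

theorem const (c : ℂ) : PrimitiveOn s (fun _ => c) 0 :=
  ⟨fun x _ y _ => IntervalIntegrable.zero, fun x _ y _ => by simp⟩

theorem add (hF : PrimitiveOn s F f) (hG : PrimitiveOn s G g) :
    PrimitiveOn s (fun x => F x + G x) (fun x => f x + g x) :=
  ⟨fun x hx y hy => (hF.integrable x hx y hy).add (hG.integrable x hx y hy), fun x hx y hy => by
    rw [intervalIntegral.integral_add (hF.integrable x hx y hy) (hG.integrable x hx y hy),
      ← hF.eq x hx y hy, ← hG.eq x hx y hy]
    ring⟩

theorem const_mul (c : ℂ) (hF : PrimitiveOn s F f) :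
    PrimitiveOn s (fun x => c * F x) (fun x => c * f x) :=
  ⟨fun x hx y hy => (hF.integrable x hx y hy).const_mul c, fun x hx y hy => by
    rw [intervalIntegral.integral_const_mul, ← hF.eq x hx y hy]
    ring⟩

theorem sub (hF : PrimitiveOn s F f) (hG : PrimitiveOn s G g) :
    PrimitiveOn s (fun x => F x - G x) (fun x => f x - g x) := by
  simpa [sub_eq_add_neg] using hF.add (hG.const_mul (-1))

theorem congr_ae (hF : PrimitiveOn s F f) (hs : s.OrdConnected)
    (h : ∀ᵐ x, x ∈ s → f x = g x) : PrimitiveOn s F g := by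
  have key : ∀ x ∈ s, ∀ y ∈ s, ∀ᵐ t, t ∈ uIoc x y → f t = g t := fun x hx y hy => by
    filter_upwards [h] with t ht hxy
    exact ht (hs.uIcc_subset hx hy (uIoc_subset_uIcc hxy))
  refine ⟨fun x hx y hy => (hF.integrable x hx y hy).congr_ae ?_, fun x hx y hy => ?_⟩
  · exact (ae_restrict_iff' measurableSet_uIoc).mpr (key x hx y hy)
  · rw [hF.eq x hx y hy, intervalIntegral.integral_congr_ae (key x hx y hy)]

theorem congr (hF : PrimitiveOn s F f) (hs : s.OrdConnected)
    (h : ∀ x ∈ s, f x = g x) : PrimitiveOn s F g :=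
  hF.congr_ae hs (Filter.Eventually.of_forall h)

theorem of_hasDerivAt (hs : s.OrdConnected) (hF : ∀ x ∈ s, HasDerivAt F (f x) x)
    (hf : ContinuousOn f s) : PrimitiveOn s F f := by
  have hi : ∀ x ∈ s, ∀ y ∈ s, IntervalIntegrable f volume x y := fun x hx y hy =>
    (hf.mono (hs.uIcc_subset hx hy)).intervalIntegrable
  exact ⟨hi, fun x hx y hy => (intervalIntegral.integral_eq_sub_of_hasDerivAt
    (fun t ht => hF t (hs.uIcc_subset hx hy ht)) (hi x hx y hy)).symm⟩

/-- A primitive is absolutely continuous, since its increments are dominated by those of the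
integral of the norm. -/
theorem absolutelyContinuousOnInterval (hF : PrimitiveOn s F f) {x y : ℝ} (hx : x ∈ s) (hy : y ∈ s)
    (hs : s.OrdConnected) : AbsolutelyContinuousOnInterval F x y := by
  have hN := (hF.integrable x hx y hy).norm.absolutelyContinuousOnInterval_intervalIntegral
    (c := x) left_mem_uIcc
  rw [absolutelyContinuousOnInterval_iff] at hN ⊢
  intro ε hε
  obtain ⟨δ, hδ, h⟩ := hN ε hε
  refine ⟨δ, hδ, fun E hE hEδ => lt_of_le_of_lt (Finset.sum_le_sum fun i hi => ?_) (h E hE hEδ)⟩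
  obtain ⟨h1, h2⟩ := hE.1 i hi
  have hs1 := hs.uIcc_subset hx hy h1
  have hs2 := hs.uIcc_subset hx hy h2
  rw [dist_comm, dist_eq_norm, hF.eq _ hs1 _ hs2, dist_comm, Real.dist_eq,
    intervalIntegral.integral_interval_sub_left (hF.integrable _ hx _ hs2).norm
      (hF.integrable _ hx _ hs1).norm]
  exact intervalIntegral.norm_integral_le_abs_integral_norm

theorem continuousOn (hF : PrimitiveOn s F f) {x y : ℝ} (hx : x ∈ s) (hy : y ∈ s)
    (hs : s.OrdConnected) : ContinuousOn F (uIcc x y) :=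
  (hF.absolutelyContinuousOnInterval hx hy hs).continuousOn

theorem ae_hasDerivAt (hF : PrimitiveOn s F f) {x y : ℝ} (hx : x ∈ s) (hy : y ∈ s)
    (hs : s.OrdConnected) : ∀ᵐ t, t ∈ uIoo x y → HasDerivAt F (f t) t := by
  filter_upwards [(hF.integrable x hx y hy).ae_hasDerivAt_integral] with t ht hxy
  have hd := ht (uIoo_subset_uIcc_self hxy) x left_mem_uIcc
  refine (hd.const_add (F x)).congr_of_eventuallyEq ?_
  filter_upwards [isOpen_Ioo.mem_nhds hxy] with u hu
  rw [← hF.eq x hx u (hs.uIcc_subset hx hy (uIoo_subset_uIcc_self hu))]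
  ring

/-- The product rule. -/
theorem mul (hF : PrimitiveOn s F f) (hG : PrimitiveOn s G g) (hs : s.OrdConnected) :
    PrimitiveOn s (fun x => F x * G x) (fun x => f x * G x + F x * g x) := by
  have hi : ∀ x ∈ s, ∀ y ∈ s,
      IntervalIntegrable (fun x => f x * G x + F x * g x) volume x y := fun x hx y hy =>
    ((hF.integrable x hx y hy).mul_continuousOn (hG.continuousOn hx hy hs)).add
      ((hG.integrable x hx y hy).continuousOn_mul (hF.continuousOn hx hy hs))
  refine ⟨hi, fun x hx y hy => ?_⟩
  -- the difference of the two sides is absolutely continuous with derivative zero almost everywhere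
  have hI : PrimitiveOn (uIcc x y) (fun u => ∫ t in x..u, (f t * G t + F t * g t))
      (fun x => f x * G x + F x * g x) := by
    refine ⟨fun u hu v hv => hi u (hs.uIcc_subset hx hy hu) v (hs.uIcc_subset hx hy hv),
      fun u hu v hv => ?_⟩
    exact intervalIntegral.integral_interval_sub_left (hi x hx v (hs.uIcc_subset hx hy hv))
      (hi x hx u (hs.uIcc_subset hx hy hu))
  have hac : AbsolutelyContinuousOnInterval
      ((F • G) - fun u => ∫ t in x..u, (f t * G t + F t * g t)) x y :=
    ((hF.absolutelyContinuousOnInterval hx hy hs).smul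
      (hG.absolutelyContinuousOnInterval hx hy hs)).sub
      (hI.absolutelyContinuousOnInterval left_mem_uIcc right_mem_uIcc ordConnected_uIcc)
  have hd : ∀ᵐ t, t ∈ uIcc x y → HasDerivAt
      ((F • G) - fun u => ∫ t in x..u, (f t * G t + F t * g t)) 0 t := by
    have hxy : ∀ᵐ t : ℝ, t ≠ x ∧ t ≠ y := by
      filter_upwards [compl_mem_ae_iff.mpr (measure_singleton (μ := volume) x),
        compl_mem_ae_iff.mpr (measure_singleton (μ := volume) y)] with t h1 h2 using ⟨h1, h2⟩
    filter_upwards [hF.ae_hasDerivAt hx hy hs, hG.ae_hasDerivAt hx hy hs,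
      hI.ae_hasDerivAt left_mem_uIcc right_mem_uIcc ordConnected_uIcc, hxy] with t h1 h2 h3 h4 ht
    have ht' : t ∈ uIoo x y := by
      rw [uIcc, mem_Icc] at ht
      rw [uIoo, mem_Ioo]
      grind
    have h := ((h1 ht').mul (h2 ht')).sub (h3 ht')
    rwa [sub_self] at h
  obtain ⟨C, hC⟩ := hac.const_of_ae_hasDerivAt_zero hd
  have e1 := hC x left_mem_uIcc
  have e2 := hC y right_mem_uIcc
  simp only [Pi.sub_apply, smul_eq_mul, Pi.mul_apply, intervalIntegral.integral_same,
    sub_zero] at e1 e2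
  linear_combination e2 - e1

theorem comp_mul_left (hF : PrimitiveOn s F f) {c : ℝ} (hc : c ≠ 0)
    (hcs : ∀ x ∈ s, c * x ∈ s) :
    PrimitiveOn s (fun x => F (c * x)) (fun x => c * f (c * x)) := by
  refine ⟨fun x hx y hy => ?_, fun x hx y hy => ?_⟩
  · have h := (hF.integrable _ (hcs x hx) _ (hcs y hy)).comp_mul_left (c := c)
    rw [mul_div_cancel_left₀ _ hc, mul_div_cancel_left₀ _ hc] at h
    exact h.const_mul _
  · rw [hF.eq _ (hcs x hx) _ (hcs y hy), intervalIntegral.integral_const_mul,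
      intervalIntegral.integral_comp_mul_left _ hc, Complex.real_smul, ← mul_assoc,
      ← Complex.ofReal_mul, mul_inv_cancel₀ hc, Complex.ofReal_one, one_mul]

theorem sub_eq_sub (hF : PrimitiveOn s F f) (hG : PrimitiveOn s G f) {x y : ℝ} (hx : x ∈ s)
    (hy : y ∈ s) : F y - G y = F x - G x := by
  linear_combination hF.eq x hx y hy - hG.eq x hx y hy

end PrimitiveOn

/-! ### Fundamental systems and boundary values -/

/-- The potential `(m² - 1/4) x⁻²`. -/
def potential (m : ℂ) (x : ℝ) : ℂ := (m ^ 2 - 1 / 4) / (x : ℂ) ^ 2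

/-- A fundamental system of solutions `p`, `q` of `L̃_m u = 0` on `ℝ₊` with Wronskian
`p q' - p' q = 1`, both square integrable near `0`. -/
structure FundamentalSystem (m : ℂ) where
  /-- the first solution -/
  p : ℝ → ℂ
  /-- the derivative of the first solution -/
  p' : ℝ → ℂ
  /-- the second solution -/
  q : ℝ → ℂ
  /-- the derivative of the second solution -/
  q' : ℝ → ℂ
  hasDerivAt_p : ∀ x > 0, HasDerivAt p (p' x) x
  hasDerivAt_p' : ∀ x > 0, HasDerivAt p' (potential m x * p x) x
  hasDerivAt_q : ∀ x > 0, HasDerivAt q (q' x) x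
  hasDerivAt_q' : ∀ x > 0, HasDerivAt q' (potential m x * q x) x
  wronskian : ∀ x > 0, p x * q' x - p' x * q x = 1
  memLp_p : ∀ R, MemLp p 2 (volume.restrict (Ioc 0 R))
  memLp_q : ∀ R, MemLp q 2 (volume.restrict (Ioc 0 R))
  contDiffOn_p : ContDiffOn ℝ ∞ p (Ioi 0)
  contDiffOn_q : ContDiffOn ℝ ∞ q (Ioi 0)

theorem continuousOn_potential (m : ℂ) : ContinuousOn (potential m) (Ioi 0) := by
  refine continuousOn_const.div (Complex.continuous_ofReal.pow 2).continuousOn fun x hx => ?_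
  simpa using (ne_of_gt hx : x ≠ 0)

/-- Elements of `L²(ℝ₊)` are integrable against functions that are square integrable near `0`. -/
theorem intervalIntegrable_mul_of_memLp (g : L2HalfLine) {w : ℝ → ℂ}
    (hw : ∀ R, MemLp w 2 (volume.restrict (Ioc 0 R))) {x y : ℝ} (hx : 0 ≤ x) (hy : 0 ≤ y) :
    IntervalIntegrable (fun t => w t * g t) volume x y := by
  have key : ∀ R : ℝ, 0 ≤ R → IntervalIntegrable (fun t => w t * g t) volume 0 R := by
    intro R hR
    rw [intervalIntegrable_iff_integrableOn_Ioc_of_le hR]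
    have hg : MemLp g 2 (volume.restrict (Ioc 0 R)) :=
      (Lp.memLp g).mono_measure (Measure.restrict_mono Ioc_subset_Ioi_self le_rfl)
    exact (hw R).integrable_mul hg
  exact (key x hx).symm.trans (key y hy)

theorem primitiveOn_integral_mul (g : L2HalfLine) {w : ℝ → ℂ}
    (hw : ∀ R, MemLp w 2 (volume.restrict (Ioc 0 R))) :
    PrimitiveOn (Ici 0) (fun x => ∫ t in (0 : ℝ)..x, w t * g t) (fun t => w t * g t) :=
  ⟨fun _ hx _ hy => intervalIntegrable_mul_of_memLp g hw hx hy, fun _ hx _ hy =>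
    intervalIntegral.integral_interval_sub_left
      (intervalIntegrable_mul_of_memLp g hw le_rfl hy)
      (intervalIntegrable_mul_of_memLp g hw le_rfl hx)⟩

namespace FundamentalSystem

variable {m : ℂ} (Φ : FundamentalSystem m)

/-- Variation of constants for `L̃_m F = g`: the coefficients `A`, `B` of `F = A p + B q`
satisfy `A' = q g`, `B' = -p g`, and have the limits `a`, `b` at `0`. -/
structure Coefficients (g : ℝ → ℂ) (a b : ℂ) (A B : ℝ → ℂ) : Prop where
  left : PrimitiveOn (Ici 0) A (fun x => Φ.q x * g x)
  right : PrimitiveOn (Ici 0) B (fun x => -(Φ.p x * g x))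
  left_zero : A 0 = a
  right_zero : B 0 = b

variable {Φ} {g : L2HalfLine} {a b : ℂ} {A B : ℝ → ℂ}

theorem exists_coefficients (g : L2HalfLine) (a b : ℂ) : ∃ A B, Φ.Coefficients g a b A B := by
  have hA := (PrimitiveOn.const (s := Ici 0) a).add (primitiveOn_integral_mul g Φ.memLp_q)
  have hB := (PrimitiveOn.const (s := Ici 0) b).sub (primitiveOn_integral_mul g Φ.memLp_p)
  refine ⟨_, _, hA.congr ordConnected_Ici fun x _ => ?_, hB.congr ordConnected_Ici fun x _ => ?_,
    ?_, ?_⟩ <;> simp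

/-- The function `A p + B q` with coefficient functions `A`, `B`. -/
def combine (Φ : FundamentalSystem m) (A B : ℝ → ℂ) (x : ℝ) : ℂ := A x * Φ.p x + B x * Φ.q x

/-- The derivative `A p' + B q'` of `A p + B q` in the method of variation of constants. -/
def combineDeriv (Φ : FundamentalSystem m) (A B : ℝ → ℂ) (x : ℝ) : ℂ :=
  A x * Φ.p' x + B x * Φ.q' x

theorem primitiveOn_p : PrimitiveOn (Ioi 0) Φ.p Φ.p' :=
  .of_hasDerivAt ordConnected_Ioi Φ.hasDerivAt_p
    fun x hx => (Φ.hasDerivAt_p' x hx).continuousAt.continuousWithinAt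

theorem primitiveOn_q : PrimitiveOn (Ioi 0) Φ.q Φ.q' :=
  .of_hasDerivAt ordConnected_Ioi Φ.hasDerivAt_q
    fun x hx => (Φ.hasDerivAt_q' x hx).continuousAt.continuousWithinAt

theorem primitiveOn_p' : PrimitiveOn (Ioi 0) Φ.p' (fun x => potential m x * Φ.p x) :=
  .of_hasDerivAt ordConnected_Ioi Φ.hasDerivAt_p' ((continuousOn_potential m).mul
    fun x hx => (Φ.hasDerivAt_p x hx).continuousAt.continuousWithinAt)

theorem primitiveOn_q' : PrimitiveOn (Ioi 0) Φ.q' (fun x => potential m x * Φ.q x) :=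
  .of_hasDerivAt ordConnected_Ioi Φ.hasDerivAt_q' ((continuousOn_potential m).mul
    fun x hx => (Φ.hasDerivAt_q x hx).continuousAt.continuousWithinAt)

theorem Coefficients.primitiveOn_combine {g : ℝ → ℂ} (h : Φ.Coefficients g a b A B) :
    PrimitiveOn (Ioi 0) (Φ.combine A B) (Φ.combineDeriv A B) := by
  have hA := h.left.mono (Ioi_subset_Ici_self : Ioi (0 : ℝ) ⊆ _)
  have hB := h.right.mono (Ioi_subset_Ici_self : Ioi (0 : ℝ) ⊆ _)
  refine ((hA.mul Φ.primitiveOn_p ordConnected_Ioi).add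
    (hB.mul Φ.primitiveOn_q ordConnected_Ioi)).congr ordConnected_Ioi fun x _ => ?_
  rw [combineDeriv]
  ring

theorem Coefficients.primitiveOn_combineDeriv {g : ℝ → ℂ} (h : Φ.Coefficients g a b A B) :
    PrimitiveOn (Ioi 0) (Φ.combineDeriv A B)
      (fun x => potential m x * Φ.combine A B x - g x) := by
  have hA := h.left.mono (Ioi_subset_Ici_self : Ioi (0 : ℝ) ⊆ _)
  have hB := h.right.mono (Ioi_subset_Ici_self : Ioi (0 : ℝ) ⊆ _)
  refine ((hA.mul Φ.primitiveOn_p' ordConnected_Ioi).add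
    (hB.mul Φ.primitiveOn_q' ordConnected_Ioi)).congr ordConnected_Ioi fun x hx => ?_
  rw [combine]
  linear_combination -(g x) * Φ.wronskian x hx

end FundamentalSystem

/-- The support of a test function on `ℝ₊` is contained in some `]r, R[` with `0 < r < R`. -/
theorem exists_Ioo_tsupport_subset {ψ : ℝ → ℂ} (hc : HasCompactSupport ψ)
    (hs : tsupport ψ ⊆ Ioi 0) : ∃ r R : ℝ, 0 < r ∧ r < R ∧ tsupport ψ ⊆ Ioo r R := by
  obtain ⟨R, hR⟩ := hc.isCompact.bddAbove
  rcases (tsupport ψ).eq_empty_or_nonempty with h | h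
  · exact ⟨1, 2, one_pos, one_lt_two, h ▸ empty_subset _⟩
  · obtain ⟨r, hr, hmin⟩ := hc.isCompact.exists_isLeast h
    have h0 : 0 < r := hs hr
    refine ⟨r / 2, R + 1, by positivity, by linarith [hR hr], fun x hx => ⟨?_, ?_⟩⟩
    · linarith [hmin hx]
    · linarith [hR hx]

theorem setIntegral_Ioi_eq_intervalIntegral {u : ℝ → ℂ} {r R : ℝ} (h0 : 0 < r) (hrR : r < R)
    (hu : ∀ x, x ∉ Ioo r R → u x = 0) : ∫ x in Ioi 0, u x = ∫ x in r..R, u x := by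
  rw [intervalIntegral.integral_of_le hrR.le]
  refine setIntegral_eq_of_subset_of_forall_sdiff_eq_zero measurableSet_Ioi
    (fun x hx => h0.trans hx.1) fun x hx => hu x fun h => hx.2 (Ioo_subset_Ioc_self h)

theorem formalL_eq_zero_of_notMem_tsupport (m : ℂ) {ψ : ℝ → ℂ} {x : ℝ} (hx : x ∉ tsupport ψ) :
    formalL m ψ x = 0 := by
  have h1 : ψ x = 0 := image_eq_zero_of_notMem_tsupport hx
  have h2 : deriv (deriv ψ) x = 0 := image_eq_zero_of_notMem_tsupport fun h =>
    hx (tsupport_deriv_subset (tsupport_deriv_subset h))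
  rw [formalL, h1, h2]
  simp

/-- If `F'` is a primitive of `V F - g`, with `V` the potential, then the primitive `F` of `F'`
solves `L̃_m F = g` in the sense of distributions. -/
theorem integral_mul_formalL {m : ℂ} {F F' g : ℝ → ℂ} (hF : PrimitiveOn (Ioi 0) F F')
    (hF' : PrimitiveOn (Ioi 0) F' (fun x => potential m x * F x - g x))
    (ψ : 𝓓(halfLine, ℂ)) :
    ∫ x in Ioi (0 : ℝ), F x * formalL m ψ x = ∫ x in Ioi (0 : ℝ), g x * ψ x := by
  obtain ⟨r, R, hr, hrR, hsupp⟩ := exists_Ioo_tsupport_subset ψ.hasCompactSupport ψ.tsupport_subset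
  have hsm : ContDiff ℝ ∞ ψ := ψ.contDiff
  have hd1 : ContDiff ℝ ∞ (deriv ψ) := ((contDiff_infty_iff_deriv).mp hsm).2
  have hd2 : ContDiff ℝ ∞ (deriv (deriv ψ)) := ((contDiff_infty_iff_deriv).mp hd1).2
  have hψ : PrimitiveOn (Ioi 0) ψ (deriv ψ) := .of_hasDerivAt ordConnected_Ioi
    (fun x _ => (hsm.differentiable (by simp) x).hasDerivAt) hd1.continuous.continuousOn
  have hψ' : PrimitiveOn (Ioi 0) (deriv ψ) (deriv (deriv ψ)) := .of_hasDerivAt ordConnected_Ioi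
    (fun x _ => (hd1.differentiable (by simp) x).hasDerivAt) hd2.continuous.continuousOn
  have hR : (0 : ℝ) < R := hr.trans hrR
  have hnot : ∀ x, x ∉ Ioo r R → x ∉ tsupport ψ := fun x hx h => hx (hsupp h)
  rw [setIntegral_Ioi_eq_intervalIntegral hr hrR fun x hx => by
      rw [formalL_eq_zero_of_notMem_tsupport m (hnot x hx), mul_zero],
    setIntegral_Ioi_eq_intervalIntegral hr hrR fun x hx => by
      rw [image_eq_zero_of_notMem_tsupport (hnot x hx), mul_zero]]
  -- `F ψ' - F' ψ` is a primitive of `g ψ - F L̃_m ψ` and vanishes at both ends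
  have hW := ((hF.mul hψ' ordConnected_Ioi).sub (hF'.mul hψ ordConnected_Ioi)).congr
    (g := fun x => g x * ψ x - F x * formalL m ψ x) ordConnected_Ioi fun x _ => by
      rw [formalL, potential]; ring
  have hFc := hF.continuousOn (mem_Ioi.2 hr) (mem_Ioi.2 hR) ordConnected_Ioi
  have hIr : r ∉ Ioo r R := fun h => lt_irrefl _ h.1
  have hIR : R ∉ Ioo r R := fun h => lt_irrefl _ h.2
  have hz : ∀ x, x ∉ Ioo r R → ψ x = 0 ∧ deriv ψ x = 0 := fun x hx =>
    ⟨image_eq_zero_of_notMem_tsupport (hnot x hx), image_eq_zero_of_notMem_tsupport fun h =>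
      hnot x hx (tsupport_deriv_subset h)⟩
  have hcont : ContinuousOn (formalL m ψ) (uIcc r R) := by
    have hsub : uIcc r R ⊆ Ioi 0 := ordConnected_Ioi.uIcc_subset hr hR
    exact hd2.continuous.continuousOn.neg.add
      (((continuousOn_potential m).mono hsub).mul ψ.continuous.continuousOn)
  have hi1 : IntervalIntegrable (fun x => F x * formalL m ψ x) volume r R :=
    (hFc.mul hcont).intervalIntegrable
  have hi2 : IntervalIntegrable (fun x => g x * ψ x) volume r R := by
    have := (hW.integrable r hr R hR).add hi1
    refine this.congr_ae (Filter.Eventually.of_forall fun x => ?_)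
    simp
  have e := hW.eq r hr R hR
  rw [intervalIntegral.integral_sub hi2 hi1, (hz r hIr).1, (hz r hIr).2, (hz R hIR).1,
    (hz R hIR).2] at e
  linear_combination e

namespace FundamentalSystem

variable {m : ℂ} {Φ : FundamentalSystem m} {f g : L2HalfLine} {a b : ℂ} {A B : ℝ → ℂ}

variable (Φ) in
/-- `f` solves `L̃_m f = g` and has the boundary values `(a, b)` at `0`: `f = A p + B q` with
variation-of-constants coefficients `A`, `B` tending to `a`, `b` at `0`. -/
def HasBoundaryValues (f g : L2HalfLine) (a b : ℂ) : Prop :=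
  ∃ A B, Φ.Coefficients g a b A B ∧ f =ᵐ[halfLineMeasure] Φ.combine A B

theorem HasBoundaryValues.mem_maxGraph (h : Φ.HasBoundaryValues f g a b) : (f, g) ∈ maxGraph m := by
  obtain ⟨A, B, hAB, hf⟩ := h
  intro ψ
  refine Eq.trans (integral_congr_ae ?_)
    (integral_mul_formalL hAB.primitiveOn_combine hAB.primitiveOn_combineDeriv ψ)
  filter_upwards [hf] with x hx
  rw [hx]

theorem HasBoundaryValues.add {f₁ g₁ f₂ g₂ : L2HalfLine} {a₁ b₁ a₂ b₂ : ℂ}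
    (h₁ : Φ.HasBoundaryValues f₁ g₁ a₁ b₁) (h₂ : Φ.HasBoundaryValues f₂ g₂ a₂ b₂) :
    Φ.HasBoundaryValues (f₁ + f₂) (g₁ + g₂) (a₁ + a₂) (b₁ + b₂) := by
  obtain ⟨A₁, B₁, h₁, hf₁⟩ := h₁
  obtain ⟨A₂, B₂, h₂, hf₂⟩ := h₂
  have hg := (ae_restrict_iff' measurableSet_Ioi).mp (Lp.coeFn_add g₁ g₂)
  have h0 : ∀ᵐ x : ℝ, x ≠ 0 := compl_mem_ae_iff.mpr (measure_singleton 0)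
  refine ⟨_, _, ⟨(h₁.left.add h₂.left).congr_ae ordConnected_Ici ?_,
    (h₁.right.add h₂.right).congr_ae ordConnected_Ici ?_, ?_, ?_⟩, ?_⟩
  · filter_upwards [hg, h0] with x hx hx0 hxs
    rw [hx (lt_of_le_of_ne hxs hx0.symm), Pi.add_apply]
    ring
  · filter_upwards [hg, h0] with x hx hx0 hxs
    rw [hx (lt_of_le_of_ne hxs hx0.symm), Pi.add_apply]
    ring
  · rw [h₁.left_zero, h₂.left_zero]
  · rw [h₁.right_zero, h₂.right_zero]
  · filter_upwards [Lp.coeFn_add f₁ f₂, hf₁, hf₂] with x hx h1 h2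
    rw [hx, Pi.add_apply, h1, h2, combine, combine, combine]
    ring

theorem HasBoundaryValues.smul (c : ℂ) (h : Φ.HasBoundaryValues f g a b) :
    Φ.HasBoundaryValues (c • f) (c • g) (c * a) (c * b) := by
  obtain ⟨A, B, h, hf⟩ := h
  have hg := (ae_restrict_iff' measurableSet_Ioi).mp (Lp.coeFn_smul c g)
  have h0 : ∀ᵐ x : ℝ, x ≠ 0 := compl_mem_ae_iff.mpr (measure_singleton 0)
  refine ⟨_, _, ⟨(h.left.const_mul c).congr_ae ordConnected_Ici ?_,
    (h.right.const_mul c).congr_ae ordConnected_Ici ?_, ?_, ?_⟩, ?_⟩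
  · filter_upwards [hg, h0] with x hx hx0 hxs
    rw [hx (lt_of_le_of_ne hxs hx0.symm), Pi.smul_apply, smul_eq_mul]
    ring
  · filter_upwards [hg, h0] with x hx hx0 hxs
    rw [hx (lt_of_le_of_ne hxs hx0.symm), Pi.smul_apply, smul_eq_mul]
    ring
  · rw [h.left_zero]
  · rw [h.right_zero]
  · filter_upwards [Lp.coeFn_smul c f, hf] with x hx h1
    rw [hx, Pi.smul_apply, h1, combine, combine, smul_eq_mul]
    ring

theorem continuousOn_p : ContinuousOn Φ.p (Ioi 0) := Φ.contDiffOn_p.continuousOn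

theorem continuousOn_q : ContinuousOn Φ.q (Ioi 0) := Φ.contDiffOn_q.continuousOn

/-- The solutions `p`, `q` are linearly independent on every interval `]0, ε[`. -/
theorem eq_zero_of_combine_eq_zero {ε : ℝ} (hε : 0 < ε)
    (h : ∀ x ∈ Ioo 0 ε, a * Φ.p x + b * Φ.q x = 0) : a = 0 ∧ b = 0 := by
  have hx : ε / 2 ∈ Ioo 0 ε := ⟨by positivity, by linarith⟩
  have hx0 : 0 < ε / 2 := hx.1
  have hd := ((Φ.hasDerivAt_p _ hx0).const_mul a).add ((Φ.hasDerivAt_q _ hx0).const_mul b)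
  have hz : HasDerivAt (fun x => a * Φ.p x + b * Φ.q x) 0 (ε / 2) :=
    (hasDerivAt_const (ε / 2) (0 : ℂ)).congr_of_eventuallyEq <| by
      filter_upwards [isOpen_Ioo.mem_nhds hx] with x hx using h x hx
  have e1 := h _ hx
  have e2 := hd.unique hz
  have w := Φ.wronskian _ hx0
  constructor
  · linear_combination -a * w + Φ.q' (ε / 2) * e1 - Φ.q (ε / 2) * e2
  · linear_combination -b * w - Φ.p' (ε / 2) * e1 + Φ.p (ε / 2) * e2

theorem HasBoundaryValues.unique {a' b' : ℂ} (h : Φ.HasBoundaryValues f g a b)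
    (h' : Φ.HasBoundaryValues f g a' b') : a = a' ∧ b = b' := by
  obtain ⟨A, B, h, hf⟩ := h
  obtain ⟨A', B', h', hf'⟩ := h'
  have h0 : (0 : ℝ) ∈ Ici (0 : ℝ) := self_mem_Ici
  have hae : (fun x => (a - a') * Φ.p x + (b - b') * Φ.q x) =ᵐ[halfLineMeasure] fun _ => 0 := by
    filter_upwards [hf, hf', ae_restrict_mem measurableSet_Ioi] with x h1 h2 hx
    have e1 := h.left.sub_eq_sub h'.left h0 (Ioi_subset_Ici_self hx)
    have e2 := h.right.sub_eq_sub h'.right h0 (Ioi_subset_Ici_self hx)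
    rw [h.left_zero, h'.left_zero] at e1
    rw [h.right_zero, h'.right_zero] at e2
    rw [← e1, ← e2]
    rw [h1, combine, combine] at h2
    linear_combination h2
  have heq := Measure.eqOn_open_of_ae_eq hae isOpen_Ioi
    ((continuousOn_const.mul Φ.continuousOn_p).add (continuousOn_const.mul Φ.continuousOn_q))
    continuousOn_const
  obtain ⟨e1, e2⟩ := eq_zero_of_combine_eq_zero (Φ := Φ) one_pos fun x hx => heq hx.1
  exact ⟨sub_eq_zero.mp e1, sub_eq_zero.mp e2⟩

/-! ### Every element of the maximal domain has boundary values -/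

theorem _root_.integrable_mul_testFunction {w : ℝ → ℂ} (hw : LocallyIntegrableOn w (Ioi 0))
    (φ : 𝓓(halfLine, ℂ)) : IntegrableOn (fun x => w x * φ x) (Ioi 0) := by
  have h := hw.integrableOn_compact_subset φ.tsupport_subset φ.hasCompactSupport
  have h2 : IntegrableOn (fun x => w x * φ x) (tsupport φ) :=
    h.mul_continuousOn φ.continuous.continuousOn φ.hasCompactSupport
  refine IntegrableOn.mono_set (t := univ) ?_ (subset_univ _)
  refine (integrableOn_iff_integrable_of_support_subset (s := tsupport φ) ?_).mp h2 |>.integrableOn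
  exact (Function.support_mul_subset_right _ _).trans (subset_tsupport φ)

/-- The linear functional `φ ↦ ∫ w φ` on test functions. -/
def _root_.pairing (w : ℝ → ℂ) (hw : LocallyIntegrableOn w (Ioi 0)) :
    𝓓(halfLine, ℂ) →ₗ[ℂ] ℂ where
  toFun φ := ∫ x in Ioi (0 : ℝ), w x * φ x
  map_add' φ ψ := by
    rw [← integral_add (integrable_mul_testFunction hw φ) (integrable_mul_testFunction hw ψ)]
    refine integral_congr_ae (Filter.Eventually.of_forall fun x => ?_)
    change w x * (φ x + ψ x) = _
    ring
  map_smul' c φ := by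
    rw [RingHom.id_apply, smul_eq_mul, ← integral_const_mul]
    refine integral_congr_ae (Filter.Eventually.of_forall fun x => ?_)
    change w x * (c * φ x) = _
    ring

theorem _root_.pairing_apply {w : ℝ → ℂ} (hw : LocallyIntegrableOn w (Ioi 0))
    (φ : 𝓓(halfLine, ℂ)) : pairing w hw φ = ∫ x in Ioi (0 : ℝ), w x * φ x := rfl

/-- A locally integrable function on `ℝ₊` that is orthogonal to all test functions vanishes. -/
theorem _root_.ae_eq_zero_of_pairing_eq_zero {w : ℝ → ℂ} (hw : LocallyIntegrableOn w (Ioi 0))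
    (h : ∀ φ : 𝓓(halfLine, ℂ), ∫ x in Ioi (0 : ℝ), w x * φ x = 0) :
    w =ᵐ[halfLineMeasure] fun _ => 0 := by
  have key := isOpen_Ioi.ae_eq_zero_of_integral_contDiff_smul_eq_zero hw (by
    intro η hη hηc hηs
    let φ : 𝓓(halfLine, ℂ) :=
      ⟨fun x => (η x : ℂ), Complex.ofRealCLM.contDiff.comp hη,
        hηc.comp_left (g := fun y : ℝ => (y : ℂ)) Complex.ofReal_zero,
        (tsupport_comp_subset (g := fun y : ℝ => (y : ℂ)) Complex.ofReal_zero η).trans hηs⟩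
    rw [← setIntegral_eq_integral_of_forall_compl_eq_zero (s := Ioi (0 : ℝ)), ← h φ]
    · refine integral_congr_ae (Filter.Eventually.of_forall fun x => ?_)
      change η x • w x = w x * (η x : ℂ)
      rw [Complex.real_smul, mul_comm]
    · intro x hx
      rw [image_eq_zero_of_notMem_tsupport (fun h' => hx (hηs h')), zero_smul])
  exact (ae_restrict_iff' measurableSet_Ioi).mpr key

theorem _root_.contDiff_mul_testFunction {w : ℝ → ℂ} (hw : ContDiffOn ℝ ∞ w (Ioi 0))
    (φ : 𝓓(halfLine, ℂ)) : ContDiff ℝ ∞ fun x => w x * φ x := by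
  rw [contDiff_iff_contDiffAt]
  intro x
  by_cases hx : x ∈ tsupport φ
  · exact (hw.contDiffAt (isOpen_Ioi.mem_nhds (φ.tsupport_subset hx))).mul φ.contDiff.contDiffAt
  · refine (contDiffAt_const (c := (0 : ℂ))).congr_of_eventuallyEq ?_
    filter_upwards [notMem_tsupport_iff_eventuallyEq.mp hx] with y hy
    rw [hy, Pi.zero_apply, mul_zero]

variable (Φ) in
/-- A test function orthogonal to `p` and `q` is `L̃_m ψ` for a test function `ψ`, namely for
`ψ = p ∫₀ˣ q φ - q ∫₀ˣ p φ`: the orthogonality makes `ψ` vanish for large `x`. -/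
theorem exists_formalL_eq (φ : 𝓓(halfLine, ℂ)) (hp : ∫ x in Ioi (0 : ℝ), Φ.p x * φ x = 0)
    (hq : ∫ x in Ioi (0 : ℝ), Φ.q x * φ x = 0) :
    ∃ ψ : 𝓓(halfLine, ℂ), ∀ x > 0, formalL m ψ x = φ x := by
  obtain ⟨r, R, hr, hrR, hsupp⟩ := exists_Ioo_tsupport_subset φ.hasCompactSupport φ.tsupport_subset
  have hφ0 : ∀ x, x ∉ Ioo r R → φ x = 0 := fun x hx =>
    image_eq_zero_of_notMem_tsupport fun h => hx (hsupp h)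
  -- primitives of `w φ` for a solution `w`
  have key : ∀ w : ℝ → ℂ, ContDiffOn ℝ ∞ w (Ioi 0) → ∫ x in Ioi (0 : ℝ), w x * φ x = 0 →
      ∃ I : ℝ → ℂ, ContDiff ℝ ∞ I ∧ (∀ x, HasDerivAt I (w x * φ x) x) ∧
        ∀ x, x ∉ Ioo r R → I x = 0 := by
    intro w hw h0
    have hsm := contDiff_mul_testFunction hw φ
    have hd : ∀ x, HasDerivAt (fun x => ∫ t in r..x, w t * φ t) (w x * φ x) x := fun x =>
      intervalIntegral.integral_hasDerivAt_right (hsm.continuous.intervalIntegrable _ _)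
        hsm.continuous.stronglyMeasurable.stronglyMeasurableAtFilter hsm.continuous.continuousAt
    refine ⟨fun x => ∫ t in r..x, w t * φ t, ?_, hd, fun x hx => ?_⟩
    · rw [contDiff_infty_iff_deriv]
      refine ⟨fun x => (hd x).differentiableAt, ?_⟩
      rwa [show deriv (fun x => ∫ t in r..x, w t * φ t) = fun x => w x * φ x from
        funext fun x => (hd x).deriv]
    · rw [setIntegral_Ioi_eq_intervalIntegral hr hrR fun x hx => by
        rw [hφ0 x hx, mul_zero]] at h0
      rcases le_or_gt x r with hxr | hxr
      · refine intervalIntegral.integral_zero_ae (Filter.Eventually.of_forall fun t ht => ?_)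
        rw [uIoc_of_ge hxr] at ht
        rw [hφ0 t (fun h => absurd h.1 (not_lt.mpr ht.2)), mul_zero]
      · have hRx : R ≤ x := not_lt.mp fun h => hx ⟨hxr, h⟩
        change ∫ t in r..x, w t * φ t = 0
        rw [← intervalIntegral.integral_add_adjacent_intervals
          (hsm.continuous.intervalIntegrable r R) (hsm.continuous.intervalIntegrable R x), h0,
          zero_add]
        refine intervalIntegral.integral_zero_ae (Filter.Eventually.of_forall fun t ht => ?_)
        rw [uIoc_of_le hRx] at ht
        rw [hφ0 t (fun h => absurd h.2 (not_lt.mpr ht.1.le)), mul_zero]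
  obtain ⟨A, hA, hdA, hA0⟩ := key Φ.q Φ.contDiffOn_q hq
  obtain ⟨B, hB, hdB, hB0⟩ := key Φ.p Φ.contDiffOn_p hp
  set ψ : ℝ → ℂ := fun x => A x * Φ.p x - B x * Φ.q x with hψ
  have hψ0 : ∀ x, x ∉ Ioo r R → ψ x = 0 := fun x hx => by simp [hψ, hA0 x hx, hB0 x hx]
  have hts : tsupport ψ ⊆ Icc r R := closure_minimal
    (fun x hx => by_contra fun h => hx (hψ0 x fun h' => h (Ioo_subset_Icc_self h'))) isClosed_Icc
  have hsm : ContDiff ℝ ∞ ψ := by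
    rw [contDiff_iff_contDiffAt]
    intro x
    rcases lt_or_ge 0 x with hx | hx
    · exact (hA.contDiffAt.mul (Φ.contDiffOn_p.contDiffAt (Ioi_mem_nhds hx))).sub
        (hB.contDiffAt.mul (Φ.contDiffOn_q.contDiffAt (Ioi_mem_nhds hx)))
    · refine (contDiffAt_const (c := (0 : ℂ))).congr_of_eventuallyEq ?_
      filter_upwards [Iio_mem_nhds (hx.trans_lt hr)] with y hy
      exact hψ0 y fun h => lt_asymm h.1 hy
  refine ⟨⟨ψ, hsm, isCompact_Icc.of_isClosed_subset (isClosed_tsupport ψ) hts,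
    fun x hx => hr.trans_le (hts hx).1⟩, fun x hx => ?_⟩
  have hd1 : ∀ y > 0, deriv ψ y = A y * Φ.p' y - B y * Φ.q' y := fun y hy => by
    have h := ((hdA y).mul (Φ.hasDerivAt_p y hy)).sub ((hdB y).mul (Φ.hasDerivAt_q y hy))
    rw [show ψ = A * Φ.p - B * Φ.q from rfl, h.deriv]
    ring
  have hd2 : deriv (deriv ψ) x = potential m x * ψ x - φ x := by
    have h := ((hdA x).mul (Φ.hasDerivAt_p' x hx)).sub ((hdB x).mul (Φ.hasDerivAt_q' x hx))
    have heq : deriv ψ =ᶠ[nhds x] (A * Φ.p' - B * Φ.q') := by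
      filter_upwards [Ioi_mem_nhds hx] with y hy using hd1 y hy
    rw [heq.deriv_eq, h.deriv]
    linear_combination -φ x * Φ.wronskian x hx
  change formalL m ψ x = φ x
  rw [formalL, hd2, potential]
  ring

variable (Φ) in
/-- Every element of the maximal domain has boundary values. The difference of `f` and the
variation-of-constants solution annihilates every test function orthogonal to `p` and `q`, so it
is a linear combination of `p` and `q`. -/
theorem exists_hasBoundaryValues (h : (f, g) ∈ maxGraph m) :
    ∃ a b, Φ.HasBoundaryValues f g a b := by
  obtain ⟨A, B, hAB⟩ := Φ.exists_coefficients g 0 0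
  have hF := hAB.primitiveOn_combine
  have hFc : ContinuousOn (Φ.combine A B) (Ioi 0) := by
    intro x hx
    have h1 : x / 2 ∈ Ioi (0 : ℝ) := half_pos (mem_Ioi.1 hx)
    have h2 : x + 1 ∈ Ioi (0 : ℝ) := add_pos (mem_Ioi.1 hx) one_pos
    refine ((hF.continuousOn h1 h2 ordConnected_Ioi).continuousAt ?_).continuousWithinAt
    rw [uIcc_of_le (by linarith [mem_Ioi.1 hx])]
    exact Icc_mem_nhds (by linarith [mem_Ioi.1 hx]) (by linarith)
  have hfl : LocallyIntegrableOn f (Ioi (0 : ℝ)) volume :=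
    locallyIntegrableOn_of_locallyIntegrable_restrict ((Lp.memLp f).locallyIntegrable (by norm_num))
  have hFl := hFc.locallyIntegrableOn (μ := volume) measurableSet_Ioi
  have hpl := Φ.continuousOn_p.locallyIntegrableOn (μ := volume) measurableSet_Ioi
  have hql := Φ.continuousOn_q.locallyIntegrableOn (μ := volume) measurableSet_Ioi
  have hmem : pairing f hfl - pairing (Φ.combine A B) hFl ∈
      Submodule.span ℂ (range ![pairing Φ.p hpl, pairing Φ.q hql]) := by
    refine mem_span_of_iInf_ker_le_ker fun φ hφ => ?_
    simp only [Submodule.mem_iInf, LinearMap.mem_ker] at hφ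
    obtain ⟨ψ, hψ⟩ := Φ.exists_formalL_eq φ (hφ 0) (hφ 1)
    have e : ∀ w : ℝ → ℂ, ∫ x in Ioi (0 : ℝ), w x * φ x = ∫ x in Ioi (0 : ℝ), w x * formalL m ψ x :=
      fun w => setIntegral_congr_fun measurableSet_Ioi fun x hx => by
        simp only [hψ x hx]
    rw [LinearMap.mem_ker, LinearMap.sub_apply, pairing_apply, pairing_apply, e, e, h ψ,
      integral_mul_formalL hF hAB.primitiveOn_combineDeriv ψ, sub_self]
  rw [Matrix.range_cons, Matrix.range_cons, Matrix.range_empty, union_empty,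
    singleton_union, Submodule.mem_span_pair] at hmem
  obtain ⟨a, b, hab⟩ := hmem
  have hw : LocallyIntegrableOn (fun x => f x - Φ.combine A B x - (a * Φ.p x + b * Φ.q x))
      (Ioi (0 : ℝ)) volume :=
    (hfl.sub hFl).sub (((continuousOn_const.mul Φ.continuousOn_p).add
      (continuousOn_const.mul Φ.continuousOn_q)).locallyIntegrableOn measurableSet_Ioi)
  have hz := ae_eq_zero_of_pairing_eq_zero hw fun φ => by
    have e := DFunLike.congr_fun hab φ
    simp only [LinearMap.add_apply, LinearMap.smul_apply, LinearMap.sub_apply, pairing_apply,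
      smul_eq_mul] at e
    have i1 := integrable_mul_testFunction hfl φ
    have i2 := integrable_mul_testFunction hFl φ
    have i3 := (integrable_mul_testFunction hpl φ).const_mul a
    have i4 := (integrable_mul_testFunction hql φ).const_mul b
    have i12 : Integrable (fun x => f x * φ x - Φ.combine A B x * φ x) halfLineMeasure := i1.sub i2
    have i34 : Integrable (fun x => a * (Φ.p x * φ x) + b * (Φ.q x * φ x)) halfLineMeasure :=
      i3.add i4
    have e' : ∫ x in Ioi (0 : ℝ), (f x - Φ.combine A B x - (a * Φ.p x + b * Φ.q x)) * φ x =
        (∫ x in Ioi (0 : ℝ), f x * φ x - Φ.combine A B x * φ x) -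
          ∫ x in Ioi (0 : ℝ), a * (Φ.p x * φ x) + b * (Φ.q x * φ x) := by
      rw [← integral_sub i12 i34]
      refine integral_congr_ae (Filter.Eventually.of_forall fun x => ?_)
      simp only
      ring
    rw [e', integral_sub i1 i2, integral_add i3 i4, integral_const_mul, integral_const_mul, e,
      sub_self]
  refine ⟨a, b, fun x => A x + a, fun x => B x + b, ⟨?_, ?_, ?_, ?_⟩, ?_⟩
  · simpa using hAB.left.add (.const a)
  · simpa using hAB.right.add (.const b)
  · rw [hAB.left_zero, zero_add]
  · rw [hAB.right_zero, zero_add]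
  · filter_upwards [hz] with x hx
    rw [combine] at hx ⊢
    linear_combination hx

end FundamentalSystem

/-! ### The Green identity -/

/-- The boundary form `∫ (g₁ f₂ - f₁ g₂)` of two elements `(f₁, g₁)`, `(f₂, g₂)` of `L² × L²`. -/
def greenForm (x y : L2HalfLine × L2HalfLine) : ℂ :=
  (∫ t in Ioi (0 : ℝ), x.2 t * y.1 t) - ∫ t in Ioi (0 : ℝ), x.1 t * y.2 t

namespace FundamentalSystem

variable {m : ℂ} {Φ : FundamentalSystem m} {f g : L2HalfLine} {a b : ℂ} {A B : ℝ → ℂ}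

theorem _root_.integrable_norm_sq (f : L2HalfLine) :
    Integrable (fun x => ‖f x‖ ^ 2) halfLineMeasure :=
  (memLp_two_iff_integrable_sq_norm (Lp.aestronglyMeasurable f)).mp (Lp.memLp f)

/-- The derivative of an element of the maximal domain is controlled by values of the function:
it differs from a difference quotient over a unit interval by at most the integral of the second
derivative, which is bounded since the second derivative is square integrable away from `0`. -/
theorem Coefficients.exists_norm_combineDeriv_le (h : Φ.Coefficients g a b A B)
    (hf : f =ᵐ[halfLineMeasure] Φ.combine A B) :
    ∃ C : ℝ, 0 ≤ C ∧ ∀ x ≥ 1, ‖Φ.combineDeriv A B x‖ ≤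
      ‖Φ.combine A B x‖ + ‖Φ.combine A B (x + 1)‖ + C := by
  set k : ℝ := ‖m ^ 2 - 1 / 4‖ with hk
  set G : ℝ → ℝ := fun t => 2 * k ^ 2 * ‖f t‖ ^ 2 + 2 * ‖g t‖ ^ 2 with hG
  have hGi : IntegrableOn G (Ioi 0) :=
    ((integrable_norm_sq f).const_mul _).add ((integrable_norm_sq g).const_mul _)
  have hG0 : ∀ t, 0 ≤ G t := fun t => by positivity
  have hC0 : 0 ≤ ∫ t in Ioi (0 : ℝ), G t := integral_nonneg hG0
  refine ⟨1 + ∫ t in Ioi (0 : ℝ), G t, by positivity, fun x hx => ?_⟩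
  have hx0 : (0 : ℝ) < x := by linarith
  have hF := h.primitiveOn_combine
  have hF' := h.primitiveOn_combineDeriv
  have hvar : ∀ t ∈ Icc x (x + 1), ‖Φ.combineDeriv A B t - Φ.combineDeriv A B x‖ ≤
      1 + ∫ t in Ioi (0 : ℝ), G t := by
    intro t ht
    have ht0 : (0 : ℝ) < t := by linarith [ht.1]
    have hsub : Ioc x t ⊆ Ioi 0 := fun u hu => hx0.trans hu.1
    have hGx : IntervalIntegrable G volume x t :=
      (intervalIntegrable_iff_integrableOn_Ioc_of_le ht.1).mpr (hGi.mono_set hsub)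
    rw [hF'.eq x hx0 t ht0]
    refine (intervalIntegral.norm_integral_le_of_norm_le (g := fun t => 1 + G t) ht.1 ?_
      (intervalIntegrable_const.add hGx)).trans ?_
    · filter_upwards [(ae_restrict_iff' measurableSet_Ioi).mp hf] with u hu hux
      have hu1 : 1 ≤ u := hx.trans hux.1.le
      rw [← hu (hsub hux)]
      have hpot : ‖potential m u‖ ≤ k := by
        rw [potential, norm_div, norm_pow, Complex.norm_real, Real.norm_of_nonneg (by linarith)]
        exact div_le_self (norm_nonneg _) (one_le_pow₀ hu1)
      have h1 : ‖potential m u * f u - g u‖ ≤ k * ‖f u‖ + ‖g u‖ :=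
        (norm_sub_le _ _).trans (by rw [norm_mul]; gcongr)
      refine h1.trans ?_
      simp only [hG]
      nlinarith [sq_nonneg (k * ‖f u‖ - 1 / 2), sq_nonneg (‖g u‖ - 1 / 2),
        sq_nonneg (k * ‖f u‖), sq_nonneg ‖g u‖]
    · rw [intervalIntegral.integral_add intervalIntegrable_const hGx,
        intervalIntegral.integral_const, smul_eq_mul, mul_one, intervalIntegral.integral_of_le ht.1]
      have : ∫ u in Ioc x t, G u ≤ ∫ u in Ioi (0 : ℝ), G u :=
        setIntegral_mono_set hGi (Filter.Eventually.of_forall hG0) (Filter.Eventually.of_forall hsub)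
      linarith [ht.2]
  have hx1 : (0 : ℝ) < x + 1 := by linarith
  have e := hF.eq x hx0 (x + 1) hx1
  have hi := hF.integrable x hx0 (x + 1) hx1
  have e2 : ∫ t in x..x + 1, (Φ.combineDeriv A B t - Φ.combineDeriv A B x) =
      Φ.combine A B (x + 1) - Φ.combine A B x - Φ.combineDeriv A B x := by
    rw [intervalIntegral.integral_sub hi intervalIntegrable_const, ← e,
      intervalIntegral.integral_const]
    simp
  have hb := intervalIntegral.norm_integral_le_of_norm_le_const
    (f := fun t => Φ.combineDeriv A B t - Φ.combineDeriv A B x) (a := x) (b := x + 1)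
    fun t ht => hvar t (by
      rw [uIoc_of_le (by linarith)] at ht
      exact Ioc_subset_Icc_self ht)
  rw [e2, add_sub_cancel_left, abs_one, mul_one] at hb
  have e3 : Φ.combineDeriv A B x = Φ.combine A B (x + 1) - Φ.combine A B x -
      (Φ.combine A B (x + 1) - Φ.combine A B x - Φ.combineDeriv A B x) := by ring
  calc ‖Φ.combineDeriv A B x‖ = ‖Φ.combine A B (x + 1) - Φ.combine A B x -
      (Φ.combine A B (x + 1) - Φ.combine A B x - Φ.combineDeriv A B x)‖ := by rw [← e3]
    _ ≤ ‖Φ.combine A B (x + 1)‖ + ‖Φ.combine A B x‖ +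
      ‖Φ.combine A B (x + 1) - Φ.combine A B x - Φ.combineDeriv A B x‖ :=
        (norm_sub_le _ _).trans (by gcongr; exact norm_sub_le _ _)
    _ ≤ _ := by linarith

/-- An integrable function and its translate by one are simultaneously small at arbitrarily large
points. -/
theorem _root_.frequently_add_comp_add_one_lt {s : ℝ → ℝ} (hs : IntegrableOn s (Ioi 0)) {ε : ℝ}
    (hε : 0 < ε) : ∃ᶠ x in Filter.atTop, s x + s (x + 1) < ε := by
  intro hcon
  obtain ⟨X, hX⟩ := Filter.eventually_atTop.mp hcon
  set Y := max X 0
  have h1 : IntegrableOn s (Ioi Y) := hs.mono_set (Ioi_subset_Ioi (le_max_right _ _))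
  have h2 : IntegrableOn (fun x => s (x + 1)) (Ioi Y) := by
    have hmp := measurePreserving_add_right (volume : Measure ℝ) 1
    have := (hmp.integrableOn_comp_preimage
      (Homeomorph.addRight (1 : ℝ)).measurableEmbedding (f := s) (s := Ioi (Y + 1))).mpr
      (h1.mono_set (Ioi_subset_Ioi (by linarith)))
    rwa [preimage_add_const_Ioi, add_sub_cancel_right] at this
  have h3 : IntegrableOn (fun _ : ℝ => ε) (Ioi Y) := by
    refine Integrable.mono' (h1.add h2) aestronglyMeasurable_const ?_
    filter_upwards [ae_restrict_mem measurableSet_Ioi] with x hx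
    rw [Real.norm_of_nonneg hε.le]
    exact not_lt.mp (hX x ((le_max_left _ _).trans (le_of_lt hx)))
  rw [integrableOn_const_iff, Real.volume_Ioi] at h3
  simp [hε.ne'] at h3

/-- The Wronskian `A₁ B₂ - A₂ B₁` of two elements of the maximal domain is small at arbitrarily
large points. -/
theorem frequently_norm_wronskian_lt {f₁ g₁ f₂ g₂ : L2HalfLine} {a₁ b₁ a₂ b₂ : ℂ}
    {A₁ B₁ A₂ B₂ : ℝ → ℂ} (h₁ : Φ.Coefficients g₁ a₁ b₁ A₁ B₁)
    (hf₁ : f₁ =ᵐ[halfLineMeasure] Φ.combine A₁ B₁) (h₂ : Φ.Coefficients g₂ a₂ b₂ A₂ B₂)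
    (hf₂ : f₂ =ᵐ[halfLineMeasure] Φ.combine A₂ B₂) {ε : ℝ} (hε : 0 < ε) :
    ∃ᶠ x in Filter.atTop, ‖A₁ x * B₂ x - A₂ x * B₁ x‖ < ε := by
  obtain ⟨C₁, hC₁, hb₁⟩ := h₁.exists_norm_combineDeriv_le hf₁
  obtain ⟨C₂, hC₂, hb₂⟩ := h₂.exists_norm_combineDeriv_le hf₂
  have hs : IntegrableOn (fun x => ‖Φ.combine A₁ B₁ x‖ ^ 2 + ‖Φ.combine A₂ B₂ x‖ ^ 2) (Ioi 0) := by
    refine ((integrable_norm_sq f₁).add (integrable_norm_sq f₂)).congr ?_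
    filter_upwards [hf₁, hf₂] with x h1 h2
    rw [Pi.add_apply, h1, h2]
  set η : ℝ := min 1 (ε / (5 + C₁ + C₂)) with hη
  have hη0 : 0 < η := lt_min one_pos (by positivity)
  have hη1 : η ≤ 1 := min_le_left _ _
  have hη2 : η * (5 + C₁ + C₂) ≤ ε := by
    rw [← le_div_iff₀ (by positivity)]
    exact min_le_right _ _
  refine ((frequently_add_comp_add_one_lt hs (pow_pos hη0 2)).and_eventually
    (Filter.eventually_ge_atTop 1)).mono ?_
  rintro x ⟨hx, hx1⟩
  have hx0 : (0 : ℝ) < x := by linarith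
  have hW : A₁ x * B₂ x - A₂ x * B₁ x = Φ.combine A₁ B₁ x * Φ.combineDeriv A₂ B₂ x -
      Φ.combineDeriv A₁ B₁ x * Φ.combine A₂ B₂ x := by
    simp only [combine, combineDeriv]
    linear_combination -(A₁ x * B₂ x - A₂ x * B₁ x) * Φ.wronskian x hx0
  have d₁ := hb₁ x hx1
  have d₂ := hb₂ x hx1
  rw [hW]
  generalize Φ.combine A₁ B₁ x = u₁ at *
  generalize Φ.combine A₂ B₂ x = u₂ at *
  generalize Φ.combine A₁ B₁ (x + 1) = v₁ at *
  generalize Φ.combine A₂ B₂ (x + 1) = v₂ at *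
  have n1 : ‖u₁‖ < η := lt_of_pow_lt_pow_left₀ 2 hη0.le (by
    linarith [sq_nonneg ‖u₂‖, sq_nonneg ‖v₁‖, sq_nonneg ‖v₂‖])
  have n2 : ‖u₂‖ < η := lt_of_pow_lt_pow_left₀ 2 hη0.le (by
    linarith [sq_nonneg ‖u₁‖, sq_nonneg ‖v₁‖, sq_nonneg ‖v₂‖])
  have n3 : ‖v₁‖ < η := lt_of_pow_lt_pow_left₀ 2 hη0.le (by
    linarith [sq_nonneg ‖u₁‖, sq_nonneg ‖u₂‖, sq_nonneg ‖v₂‖])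
  have n4 : ‖v₂‖ < η := lt_of_pow_lt_pow_left₀ 2 hη0.le (by
    linarith [sq_nonneg ‖u₁‖, sq_nonneg ‖v₁‖, sq_nonneg ‖u₂‖])
  calc _ ≤ ‖u₁‖ * ‖Φ.combineDeriv A₂ B₂ x‖ + ‖Φ.combineDeriv A₁ B₁ x‖ * ‖u₂‖ := by
        rw [← norm_mul, ← norm_mul]
        exact norm_sub_le _ _
    _ ≤ η * (1 + 1 + C₂) + (1 + 1 + C₁) * η := by
        gcongr <;> linarith
    _ < ε := by nlinarith

/-- Green's identity. The Wronskian `A₁ B₂ - A₂ B₁` has derivative `g₁ f₂ - f₁ g₂`, tends to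
`a₁ b₂ - a₂ b₁` at `0` and to `0` at infinity. -/
theorem HasBoundaryValues.greenForm_eq {f₁ g₁ f₂ g₂ : L2HalfLine} {a₁ b₁ a₂ b₂ : ℂ}
    (h₁ : Φ.HasBoundaryValues f₁ g₁ a₁ b₁) (h₂ : Φ.HasBoundaryValues f₂ g₂ a₂ b₂) :
    greenForm (f₁, g₁) (f₂, g₂) = a₂ * b₁ - a₁ * b₂ := by
  obtain ⟨A₁, B₁, h₁, hf₁⟩ := h₁
  obtain ⟨A₂, B₂, h₂, hf₂⟩ := h₂
  have h0 : ∀ᵐ x : ℝ, x ≠ 0 := compl_mem_ae_iff.mpr (measure_singleton 0)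
  have hW : PrimitiveOn (Ici 0) (fun x => A₁ x * B₂ x - A₂ x * B₁ x)
      (fun x => g₁ x * f₂ x - f₁ x * g₂ x) := by
    refine ((h₁.left.mul h₂.right ordConnected_Ici).sub
      (h₂.left.mul h₁.right ordConnected_Ici)).congr_ae ordConnected_Ici ?_
    filter_upwards [(ae_restrict_iff' measurableSet_Ioi).mp hf₁,
      (ae_restrict_iff' measurableSet_Ioi).mp hf₂, h0] with x e1 e2 hx hx0
    have hx' : x ∈ Ioi (0 : ℝ) := lt_of_le_of_ne hx0 hx.symm
    rw [e1 hx', e2 hx', combine, combine]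
    ring
  have hi1 := L2HalfLine_integrable_mul g₁ (Lp.memLp f₂)
  have hi2 := L2HalfLine_integrable_mul f₁ (Lp.memLp g₂)
  have hlim := intervalIntegral_tendsto_integral_Ioi 0 (hi1.sub hi2) Filter.tendsto_id
  simp only [Pi.sub_apply, id] at hlim
  rw [integral_sub hi1 hi2] at hlim
  set I := greenForm (f₁, g₁) (f₂, g₂) with hI
  change Filter.Tendsto _ _ (nhds I) at hlim
  have hlim2 : Filter.Tendsto (fun x => A₁ x * B₂ x - A₂ x * B₁ x) Filter.atTop
      (nhds ((a₁ * b₂ - a₂ * b₁) + I)) := by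
    refine (hlim.const_add _).congr' ?_
    filter_upwards [Filter.eventually_ge_atTop 0] with x hx
    rw [← hW.eq 0 self_mem_Ici x hx, h₁.left_zero, h₁.right_zero, h₂.left_zero, h₂.right_zero]
    ring
  suffices hz : (a₁ * b₂ - a₂ * b₁) + I = 0 by linear_combination hz
  by_contra hne
  have hpos := norm_pos_iff.mpr hne
  have hev := hlim2.norm.eventually_const_lt (half_lt_self hpos)
  obtain ⟨x, hx1, hx2⟩ := ((frequently_norm_wronskian_lt h₁ hf₁ h₂ hf₂
    (half_pos hpos)).and_eventually hev).exists
  exact lt_asymm hx1 hx2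

/-! ### Boundary values of explicit functions and of dilated functions -/

theorem deriv_eq_of_eq_solution {F : ℝ → ℂ} {ε : ℝ}
    (hnear : ∀ x ∈ Ioo 0 ε, F x = a * Φ.p x + b * Φ.q x) :
    (∀ x ∈ Ioo 0 ε, deriv F x = a * Φ.p' x + b * Φ.q' x) ∧
      ∀ x ∈ Ioo 0 ε, deriv (deriv F) x = potential m x * F x := by
  have hd1 : ∀ x ∈ Ioo 0 ε, deriv F x = a * Φ.p' x + b * Φ.q' x := fun x hx => by
    have hd := ((Φ.hasDerivAt_p x hx.1).const_mul a).add ((Φ.hasDerivAt_q x hx.1).const_mul b)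
    refine (hd.congr_of_eventuallyEq ?_).deriv
    filter_upwards [isOpen_Ioo.mem_nhds hx] with y hy using hnear y hy
  refine ⟨hd1, fun x hx => ?_⟩
  have hd := ((Φ.hasDerivAt_p' x hx.1).const_mul a).add ((Φ.hasDerivAt_q' x hx.1).const_mul b)
  have hd' : HasDerivAt (deriv F) _ x := hd.congr_of_eventuallyEq <| by
    filter_upwards [isOpen_Ioo.mem_nhds hx] with y hy using hd1 y hy
  rw [hd'.deriv, hnear x hx]
  ring

/-- A smooth function that coincides with `a p + b q` near `0` has boundary values `(a, b)`. -/
theorem hasBoundaryValues_of_contDiffOn {F : ℝ → ℂ} (hF : ContDiffOn ℝ ∞ F (Ioi 0)) {ε : ℝ}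
    (hε : 0 < ε) (hnear : ∀ x ∈ Ioo 0 ε, F x = a * Φ.p x + b * Φ.q x)
    (hf : f =ᵐ[halfLineMeasure] F)
    (hg : g =ᵐ[halfLineMeasure] fun x => potential m x * F x - deriv (deriv F) x) :
    Φ.HasBoundaryValues f g a b := by
  obtain ⟨A, B, h⟩ := Φ.exists_coefficients g a b
  obtain ⟨hFd, hF1⟩ := (contDiffOn_infty_iff_deriv_of_isOpen isOpen_Ioi).mp hF
  obtain ⟨hFd1, hF2⟩ := (contDiffOn_infty_iff_deriv_of_isOpen isOpen_Ioi).mp hF1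
  have P0 : PrimitiveOn (Ioi 0) F (deriv F) := .of_hasDerivAt ordConnected_Ioi
    (fun x hx => (hFd.differentiableAt (Ioi_mem_nhds hx)).hasDerivAt) hF1.continuousOn
  have P1 : PrimitiveOn (Ioi 0) (deriv F) (deriv (deriv F)) := .of_hasDerivAt ordConnected_Ioi
    (fun x hx => (hFd1.differentiableAt (Ioi_mem_nhds hx)).hasDerivAt) hF2.continuousOn
  have hg' := (ae_restrict_iff' measurableSet_Ioi).mp hg
  have hA : PrimitiveOn (Ioi 0) (fun x => F x * Φ.q' x - deriv F x * Φ.q x)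
      (fun x => Φ.q x * g x) := by
    refine ((P0.mul Φ.primitiveOn_q' ordConnected_Ioi).sub
      (P1.mul Φ.primitiveOn_q ordConnected_Ioi)).congr_ae ordConnected_Ioi ?_
    filter_upwards [hg'] with x hx hx0
    rw [hx hx0]
    ring
  have hB : PrimitiveOn (Ioi 0) (fun x => Φ.p x * deriv F x - Φ.p' x * F x)
      (fun x => -(Φ.p x * g x)) := by
    refine ((Φ.primitiveOn_p.mul P1 ordConnected_Ioi).sub
      (Φ.primitiveOn_p'.mul P0 ordConnected_Ioi)).congr_ae ordConnected_Ioi ?_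
    filter_upwards [hg'] with x hx hx0
    rw [hx hx0]
    ring
  obtain ⟨hd1, hd2⟩ := deriv_eq_of_eq_solution hnear
  have hg0 : ∀ᵐ x, x ∈ Ioc 0 (ε / 2) → g x = 0 := by
    filter_upwards [hg'] with x hx hxε
    rw [hx hxε.1, hd2 x ⟨hxε.1, by linarith [hxε.2]⟩, sub_self]
  have hy : ε / 2 ∈ Ioo 0 ε := ⟨by positivity, by linarith⟩
  have hy0 : (0 : ℝ) < ε / 2 := hy.1
  have hint : ∀ w : ℝ → ℂ, ∫ t in 0..ε / 2, w t * g t = 0 := fun w => by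
    refine intervalIntegral.integral_zero_ae ?_
    rw [uIoc_of_le hy0.le]
    filter_upwards [hg0] with t ht hts
    rw [ht hts, mul_zero]
  have hAy : A (ε / 2) = a := by
    have e := h.left.eq 0 self_mem_Ici _ hy0.le
    rw [hint, h.left_zero] at e
    exact sub_eq_zero.mp e
  have hBy : B (ε / 2) = b := by
    have e := h.right.eq 0 self_mem_Ici _ hy0.le
    rw [intervalIntegral.integral_neg, hint, neg_zero, h.right_zero] at e
    exact sub_eq_zero.mp e
  have hw := Φ.wronskian _ hy0
  refine ⟨A, B, h, ?_⟩
  filter_upwards [hf, ae_restrict_mem measurableSet_Ioi] with x hx hx0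
  have eA := (h.left.mono Ioi_subset_Ici_self).sub_eq_sub hA hy0 hx0
  have eB := (h.right.mono Ioi_subset_Ici_self).sub_eq_sub hB hy0 hx0
  rw [hAy, hnear _ hy, hd1 _ hy] at eA
  rw [hBy, hnear _ hy, hd1 _ hy] at eB
  have eA' : A x = F x * Φ.q' x - deriv F x * Φ.q x := by linear_combination eA - a * hw
  have eB' : B x = Φ.p x * deriv F x - Φ.p' x * F x := by linear_combination eB - b * hw
  rw [hx, combine, eA', eB']
  linear_combination -(F x) * Φ.wronskian x hx0

theorem _root_.memLp_of_eq_zero_of_two_lt {F : ℝ → ℂ} (h : MemLp F 2 (volume.restrict (Ioc 0 2)))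
    (h2 : ∀ x > 2, F x = 0) : MemLp F 2 halfLineMeasure := by
  have h1 : MemLp ((Ioc (0 : ℝ) 2).indicator F) 2 volume :=
    (memLp_indicator_iff_restrict measurableSet_Ioc).mpr h
  refine (memLp_congr_ae ?_).mp (h1.mono_measure (Measure.restrict_le_self (s := Ioi 0)))
  filter_upwards [ae_restrict_mem measurableSet_Ioi] with x hx
  by_cases hx2 : x ≤ 2
  · rw [indicator_of_mem (show x ∈ Ioc (0 : ℝ) 2 from ⟨hx, hx2⟩)]
  · rw [indicator_of_notMem (fun h => hx2 h.2), h2 x (not_le.mp hx2)]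

theorem _root_.exists_bound_on_Icc {F : ℝ → ℂ} (hF : ContinuousOn F (Ioi 0)) :
    ∃ C, ∀ x ∈ Icc (1 : ℝ) 2, ‖F x‖ ≤ C :=
  isCompact_Icc.exists_bound_of_continuousOn
    (hF.mono fun _ hx => mem_Ioi.2 (one_pos.trans_le hx.1))

variable (Φ) in
/-- The function `ξ (a p + b q)` lies in the maximal domain and has boundary values `(a, b)`. -/
theorem exists_cutoff_hasBoundaryValues {ξ : ℝ → ℂ} (hξ : IsCutoff ξ) (a b : ℂ) :
    ∃ f g : L2HalfLine, (f =ᵐ[halfLineMeasure] fun x => ξ x * (a * Φ.p x + b * Φ.q x)) ∧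
      Φ.HasBoundaryValues f g a b := by
  set w : ℝ → ℂ := fun x => a * Φ.p x + b * Φ.q x with hw
  have hwsm : ContDiffOn ℝ ∞ w (Ioi 0) :=
    (contDiffOn_const.mul Φ.contDiffOn_p).add (contDiffOn_const.mul Φ.contDiffOn_q)
  have hwL : MemLp w 2 (volume.restrict (Ioc 0 2)) :=
    ((Φ.memLp_p 2).const_mul a).add ((Φ.memLp_q 2).const_mul b)
  set F : ℝ → ℂ := fun x => ξ x * w x with hFdef
  have hF : ContDiffOn ℝ ∞ F (Ioi 0) := hξ.smooth.mul hwsm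
  have hF2 := ((contDiffOn_infty_iff_deriv_of_isOpen isOpen_Ioi).mp
    ((contDiffOn_infty_iff_deriv_of_isOpen isOpen_Ioi).mp hF).2).2
  have hnear : ∀ x ∈ Ioo (0 : ℝ) 1, F x = a * Φ.p x + b * Φ.q x := fun x hx => by
    simp only [hFdef, hw, hξ.eq_one x ⟨hx.1, hx.2.le⟩, one_mul]
  have hfar : ∀ x ∈ Ioi (2 : ℝ), F x = 0 := fun x hx => by
    simp only [hFdef, hξ.eq_zero x (mem_Ici.2 (mem_Ioi.1 hx).le), zero_mul]
  have hFL : MemLp F 2 halfLineMeasure := by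
    refine memLp_of_eq_zero_of_two_lt ?_ hfar
    obtain ⟨C, hC⟩ := exists_bound_on_Icc hξ.smooth.continuousOn
    refine hwL.of_le_mul (c := max 1 C) ?_ ?_
    · exact (hF.continuousOn.mono Ioc_subset_Ioi_self).aestronglyMeasurable measurableSet_Ioc
    · filter_upwards [ae_restrict_mem measurableSet_Ioc] with x hx
      simp only [hFdef, norm_mul]
      gcongr
      rcases le_total x 1 with h | h
      · rw [hξ.eq_one x ⟨hx.1, h⟩, norm_one]
        exact le_max_left _ _
      · exact (hC x ⟨h, hx.2⟩).trans (le_max_right _ _)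
  set G : ℝ → ℂ := fun x => potential m x * F x - deriv (deriv F) x with hG
  have hGc : ContinuousOn G (Ioi 0) :=
    ((continuousOn_potential m).mul hF.continuousOn).sub hF2.continuousOn
  have hGnear : ∀ x ∈ Ioo (0 : ℝ) 1, G x = 0 := fun x hx => by
    simp only [hG, (deriv_eq_of_eq_solution hnear).2 x hx, sub_self]
  have hGfar : ∀ x ∈ Ioi (2 : ℝ), G x = 0 := fun x hx => by
    have h1 : F =ᶠ[nhds x] fun _ => 0 := by
      filter_upwards [isOpen_Ioi.mem_nhds hx] with y hy using hfar y hy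
    simp only [hG]
    rw [hfar x hx, h1.deriv.deriv_eq]
    simp
  have hGL : MemLp G 2 halfLineMeasure := by
    refine memLp_of_eq_zero_of_two_lt ?_ hGfar
    obtain ⟨C, hC⟩ := exists_bound_on_Icc hGc
    refine MemLp.of_bound ((hGc.mono Ioc_subset_Ioi_self).aestronglyMeasurable measurableSet_Ioc)
      (max 0 C) ?_
    filter_upwards [ae_restrict_mem measurableSet_Ioc] with x hx
    rcases lt_or_ge x 1 with h | h
    · rw [hGnear x ⟨hx.1, h⟩, norm_zero]
      exact le_max_left _ _
    · exact (hC x ⟨h, hx.2⟩).trans (le_max_right _ _)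
  exact ⟨hFL.toLp F, hGL.toLp G, hFL.coeFn_toLp,
    hasBoundaryValues_of_contDiffOn hF one_pos hnear hFL.coeFn_toLp hGL.coeFn_toLp⟩

/-- Dilations act on boundary values as they act on the solutions `p` and `q`. -/
theorem HasBoundaryValues.dilation {τ : ℝ} {l μ ν : ℂ} (h : Φ.HasBoundaryValues f g a b)
    (hp : ∀ x > 0, Φ.p (Real.exp τ * x) = l * Φ.p x)
    (hq : ∀ x > 0, Φ.q (Real.exp τ * x) = μ * Φ.q x + ν * Φ.p x)
    (hlμ : l * μ = (Real.exp τ : ℂ)) :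
    Φ.HasBoundaryValues (dilation τ f) (((Real.exp (2 * τ) : ℝ) : ℂ) • dilation τ g)
      (((Real.exp (τ / 2) : ℝ) : ℂ) * (l * a + ν * b)) (((Real.exp (τ / 2) : ℝ) : ℂ) * (μ * b)) := by
  obtain ⟨A, B, h, hf⟩ := h
  have h0 : ∀ᵐ x : ℝ, x ≠ 0 := compl_mem_ae_iff.mpr (measure_singleton 0)
  set κ : ℂ := ((Real.exp (τ / 2) : ℝ) : ℂ) with hκ
  have hexp : ((Real.exp (2 * τ) : ℝ) : ℂ) = (Real.exp τ : ℂ) * (Real.exp τ : ℂ) := by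
    rw [← Complex.ofReal_mul, ← Real.exp_add]
    ring_nf
  have hg' := (ae_restrict_iff' measurableSet_Ioi).mp
    ((Lp.coeFn_smul ((Real.exp (2 * τ) : ℝ) : ℂ) (_root_.dilation τ g)).and
      (coeFn_dilationFun τ g))
  have hsmul : ∀ x ∈ Ici (0 : ℝ), Real.exp τ * x ∈ Ici (0 : ℝ) := fun x hx =>
    mul_nonneg (Real.exp_pos _).le hx
  have hA := h.left.comp_mul_left (Real.exp_ne_zero τ) hsmul
  have hB := h.right.comp_mul_left (Real.exp_ne_zero τ) hsmul
  have hG : ∀ᵐ x, x ∈ Ici (0 : ℝ) → 0 < x ∧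
      ((((Real.exp (2 * τ) : ℝ) : ℂ) • _root_.dilation τ g : L2HalfLine) : ℝ → ℂ) x =
        (Real.exp τ : ℂ) * (Real.exp τ : ℂ) * (κ * g (Real.exp τ * x)) := by
    filter_upwards [hg', h0] with x hx hx0 hxs
    have hx' : 0 < x := lt_of_le_of_ne hxs hx0.symm
    refine ⟨hx', ?_⟩
    rw [(hx hx').1, Pi.smul_apply, smul_eq_mul, ← hexp]
    congr 1
    exact (hx hx').2
  refine ⟨fun x => κ * (l * A (Real.exp τ * x) + ν * B (Real.exp τ * x)),
    fun x => κ * (μ * B (Real.exp τ * x)), ⟨?_, ?_, ?_, ?_⟩, ?_⟩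
  · refine (((hA.const_mul l).add (hB.const_mul ν)).const_mul κ).congr_ae ordConnected_Ici ?_
    filter_upwards [hG] with x hx hxs
    obtain ⟨hx0, hx⟩ := hx hxs
    rw [hx, hp x hx0, hq x hx0, ← hlμ]
    ring
  · refine ((hB.const_mul μ).const_mul κ).congr_ae ordConnected_Ici ?_
    filter_upwards [hG] with x hx hxs
    obtain ⟨hx0, hx⟩ := hx hxs
    rw [hx, hp x hx0, ← hlμ]
    ring
  · simp only [mul_zero, h.left_zero, h.right_zero]
  · simp only [mul_zero, h.right_zero]
  · filter_upwards [coeFn_dilationFun τ f, (quasiMeasurePreserving_mul τ).ae_eq_comp hf,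
      ae_restrict_mem measurableSet_Ioi] with x h1 h2 hx
    simp only [Function.comp_apply] at h2
    refine h1.trans ?_
    rw [h2, combine, combine, hp x hx, hq x hx]
    ring

end FundamentalSystem

/-! ### The minimal operator as the annihilator of the maximal operator -/

/-- For a test function `φ`, the pair `(φ, L̃_m φ)` belongs to the maximal operator. -/
theorem testFunction_mem_maxGraph (m : ℂ) (φ : 𝓓(halfLine, ℂ)) :
    ((testFunction_memLp φ).toLp φ, (formalL_memLp m φ).toLp (formalL m φ)) ∈ maxGraph m := by
  intro ψ
  have hsm : ContDiff ℝ ∞ φ := φ.contDiff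
  have hd1 : ContDiff ℝ ∞ (deriv φ) := ((contDiff_infty_iff_deriv).mp hsm).2
  have hd2 : ContDiff ℝ ∞ (deriv (deriv φ)) := ((contDiff_infty_iff_deriv).mp hd1).2
  have h0 : PrimitiveOn (Ioi 0) φ (deriv φ) := .of_hasDerivAt ordConnected_Ioi
    (fun x _ => (hsm.differentiable (by simp) x).hasDerivAt) hd1.continuous.continuousOn
  have h1 : PrimitiveOn (Ioi 0) (deriv φ) (deriv (deriv φ)) := .of_hasDerivAt ordConnected_Ioi
    (fun x _ => (hd1.differentiable (by simp) x).hasDerivAt) hd2.continuous.continuousOn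
  have e := integral_mul_formalL (m := m) (g := formalL m φ) h0
    (h1.congr ordConnected_Ioi fun x _ => by rw [formalL, potential]; ring) ψ
  refine Eq.trans (integral_congr_ae ?_) (e.trans (integral_congr_ae ?_))
  · filter_upwards [(testFunction_memLp φ).coeFn_toLp] with x hx
    rw [hx]
  · filter_upwards [(formalL_memLp m φ).coeFn_toLp] with x hx
    rw [hx]

/-- The graph of the operator on `C_c^∞(ℝ₊)` whose closure is the minimal operator. -/
theorem mem_graph_domRestrict_smoothCompact {m : ℂ} {x : L2HalfLine × L2HalfLine} :
    x ∈ ((Lmax m).domRestrict smoothCompact).graph ↔ ∃ φ : 𝓓(halfLine, ℂ),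
      x = ((testFunction_memLp φ).toLp φ, (formalL_memLp m φ).toLp (formalL m φ)) := by
  constructor
  · intro hx
    have hx' : x ∈ maxGraph m := by
      rw [← Lmax_graph]
      exact LinearPMap.le_graph_of_le LinearPMap.domRestrict_le hx
    have hdom := LinearPMap.mem_domain_of_mem_graph (x := x.1) (y := x.2) hx
    obtain ⟨φ, hφ⟩ : x.1 ∈ smoothCompact := hdom.1
    have h1 : x.1 = (testFunction_memLp φ).toLp φ :=
      Lp.ext (hφ.trans (testFunction_memLp φ).coeFn_toLp.symm)
    refine ⟨φ, Prod.ext h1 ?_⟩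
    have hd := (maxGraph m).sub_mem hx' (testFunction_mem_maxGraph m φ)
    exact sub_eq_zero.mp (maxGraph_functional m _ hd (sub_eq_zero.mpr h1))
  · rintro ⟨φ, rfl⟩
    have hm := testFunction_mem_maxGraph m φ
    rw [← Lmax_graph] at hm
    have hdom := LinearPMap.mem_domain_of_mem_graph hm
    have hs : (testFunction_memLp φ).toLp φ ∈ smoothCompact :=
      ⟨φ, (testFunction_memLp φ).coeFn_toLp⟩
    rw [LinearPMap.mem_graph_iff]
    have hr : (testFunction_memLp φ).toLp φ ∈ ((Lmax m).domRestrict smoothCompact).domain :=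
      ⟨hs, hdom⟩
    exact ⟨⟨_, hr⟩, rfl, (LinearPMap.domRestrict_le.2 (x := ⟨_, hr⟩) (y := ⟨_, hdom⟩) rfl).trans
      ((LinearPMap.image_iff hdom).mpr hm).symm⟩

/-- Riesz representation with respect to the bilinear pairing `∫ v h`. -/
theorem exists_eq_integral_mul (l : StrongDual ℂ L2HalfLine) :
    ∃ h : L2HalfLine, ∀ v : L2HalfLine, l v = ∫ x in Ioi (0 : ℝ), v x * h x := by
  set k := (InnerProductSpace.toDual ℂ L2HalfLine).symm l with hk
  have hs : MemLp (fun x => star (k x)) 2 halfLineMeasure := (Lp.memLp k).star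
  refine ⟨hs.toLp _, fun v => ?_⟩
  rw [← InnerProductSpace.toDual_symm_apply (𝕜 := ℂ) (y := l), ← hk, L2.inner_def]
  refine integral_congr_ae ?_
  filter_upwards [hs.coeFn_toLp] with x hx
  rw [hx]
  simp

/-- A point outside a closed subspace is separated from it by a continuous linear functional
vanishing on the subspace. -/
theorem exists_strongDual_eq_zero_of_notMem {E : Type*} [NormedAddCommGroup E] [NormedSpace ℂ E]
    {K : Submodule ℂ E} (hK : IsClosed (K : Set E)) {x : E} (hx : x ∉ K) :
    ∃ l : StrongDual ℂ E, (∀ y ∈ K, l y = 0) ∧ l x ≠ 0 := by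
  obtain ⟨l, u, hlu, hux⟩ := RCLike.geometric_hahn_banach_closed_point (𝕜 := ℂ)
    (K.restrictScalars ℝ).convex hK hx
  have hz : ∀ y ∈ K, l y = 0 := by
    intro y hy
    by_contra hne
    have h := hlu (((u : ℂ) * (l y)⁻¹) • y) (K.smul_mem _ hy)
    rw [map_smul, smul_eq_mul, mul_assoc, inv_mul_cancel₀ hne, mul_one] at h
    simp at h
  refine ⟨l, hz, fun h => ?_⟩
  have h0 := hlu 0 K.zero_mem
  rw [h] at hux
  simp at h0 hux
  linarith

/-- The graph of the minimal operator is the annihilator of the graph of the maximal operator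
under the boundary form: the annihilator of the graph over the test functions is the maximal
graph by definition, and a double annihilator is a closure. -/
theorem mem_graph_Lmin_iff {m : ℂ} {x : L2HalfLine × L2HalfLine} :
    x ∈ (Lmin m).graph ↔ ∀ y ∈ maxGraph m, greenForm x y = 0 := by
  rw [Lmin, ← (Lmax_restrict_isClosable m).graph_closure_eq_closure_graph]
  constructor
  · intro hx y hy
    have hcl : IsClosed {x : L2HalfLine × L2HalfLine | greenForm x y = 0} :=
      isClosed_eq (((continuous_L2HalfLine_integral (Lp.memLp y.1)).comp continuous_snd).sub
        ((continuous_L2HalfLine_integral (Lp.memLp y.2)).comp continuous_fst)) continuous_const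
    refine closure_minimal (fun z hz => ?_) hcl hx
    obtain ⟨φ, rfl⟩ := mem_graph_domRestrict_smoothCompact.mp hz
    change greenForm _ y = 0
    rw [greenForm, sub_eq_zero]
    refine Eq.trans (integral_congr_ae ?_) ((hy φ).trans (integral_congr_ae ?_))
    · filter_upwards [(formalL_memLp m φ).coeFn_toLp] with t ht
      rw [ht, mul_comm]
    · filter_upwards [(testFunction_memLp φ).coeFn_toLp] with t ht
      rw [ht, mul_comm]
  · intro h
    by_contra hx
    obtain ⟨l, hl0, hlx⟩ := exists_strongDual_eq_zero_of_notMem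
      (Submodule.isClosed_topologicalClosure _) hx
    obtain ⟨k, hk⟩ := exists_eq_integral_mul (l.comp (ContinuousLinearMap.inl ℂ _ _))
    obtain ⟨w, hw⟩ := exists_eq_integral_mul (l.comp (ContinuousLinearMap.inr ℂ _ _))
    have hl : ∀ z : L2HalfLine × L2HalfLine, l z =
        (∫ t in Ioi (0 : ℝ), z.1 t * k t) + ∫ t in Ioi (0 : ℝ), z.2 t * w t := by
      intro z
      rw [← hk, ← hw]
      simp [← map_add]
    have hneg : ∀ ψ : ℝ → ℂ, ∫ t in Ioi (0 : ℝ), ψ t * (-k : L2HalfLine) t =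
        -∫ t in Ioi (0 : ℝ), ψ t * k t := by
      intro ψ
      rw [← integral_neg]
      refine integral_congr_ae ?_
      filter_upwards [Lp.coeFn_neg k] with t ht
      rw [ht, Pi.neg_apply, mul_neg]
    have hmem : (w, -k) ∈ maxGraph m := by
      intro φ
      have e := hl0 _ (Submodule.le_topologicalClosure _
        (mem_graph_domRestrict_smoothCompact.mpr ⟨φ, rfl⟩))
      rw [hl] at e
      have e1 : ∫ t in Ioi (0 : ℝ), (testFunction_memLp φ).toLp φ t * k t =
          ∫ t in Ioi (0 : ℝ), φ t * k t := integral_congr_ae <| by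
        filter_upwards [(testFunction_memLp φ).coeFn_toLp] with t ht
        rw [ht]
      have e2 : ∫ t in Ioi (0 : ℝ), (formalL_memLp m φ).toLp (formalL m φ) t * w t =
          ∫ t in Ioi (0 : ℝ), formalL m φ t * w t := integral_congr_ae <| by
        filter_upwards [(formalL_memLp m φ).coeFn_toLp] with t ht
        rw [ht]
      simp only at e
      rw [e1, e2] at e
      simp only [mul_comm (w _), mul_comm ((-k : L2HalfLine) _)]
      rw [hneg]
      linear_combination e
    refine hlx ?_
    have e := h _ hmem
    rw [greenForm, hneg] at e
    rw [hl]
    linear_combination e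

theorem Lmin_le_Lmax (m : ℂ) : Lmin m ≤ Lmax m := by
  refine LinearPMap.le_of_le_graph ?_
  rw [Lmin, ← (Lmax_restrict_isClosable m).graph_closure_eq_closure_graph]
  exact Submodule.topologicalClosure_minimal _
    (LinearPMap.le_graph_of_le LinearPMap.domRestrict_le) (Lmax_isClosed m)

/-! ### Operators between the minimal and the maximal one -/

theorem mem_maxGraph_of_mem_domain {m : ℂ} (f : (Lmax m).domain) :
    ((f : L2HalfLine), Lmax m f) ∈ maxGraph m := by
  rw [← Lmax_graph]
  exact LinearPMap.mem_graph _ f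

namespace FundamentalSystem

variable {m : ℂ} (Φ : FundamentalSystem m)

theorem exists_boundaryValue (f : (Lmax m).domain) :
    ∃ v : ℂ × ℂ, Φ.HasBoundaryValues f (Lmax m f) v.1 v.2 := by
  obtain ⟨a, b, h⟩ := Φ.exists_hasBoundaryValues (mem_maxGraph_of_mem_domain f)
  exact ⟨(a, b), h⟩

variable {Φ} in
theorem HasBoundaryValues.eq {f g : L2HalfLine} {v w : ℂ × ℂ}
    (h : Φ.HasBoundaryValues f g v.1 v.2) (h' : Φ.HasBoundaryValues f g w.1 w.2) : v = w :=
  Prod.ext (h.unique h').1 (h.unique h').2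

/-- The boundary values of the elements of the maximal domain. -/
def boundaryMap : (Lmax m).domain →ₗ[ℂ] ℂ × ℂ where
  toFun f := (Φ.exists_boundaryValue f).choose
  map_add' f₁ f₂ := by
    have h := (Φ.exists_boundaryValue f₁).choose_spec.add (Φ.exists_boundaryValue f₂).choose_spec
    rw [← LinearPMap.map_add] at h
    exact (Φ.exists_boundaryValue (f₁ + f₂)).choose_spec.eq h
  map_smul' c f := by
    have h := (Φ.exists_boundaryValue f).choose_spec.smul c
    rw [← LinearPMap.map_smul] at h
    exact (Φ.exists_boundaryValue (c • f)).choose_spec.eq h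

theorem hasBoundaryValues_boundaryMap (f : (Lmax m).domain) :
    Φ.HasBoundaryValues f (Lmax m f) (Φ.boundaryMap f).1 (Φ.boundaryMap f).2 :=
  (Φ.exists_boundaryValue f).choose_spec

variable {Φ} in
theorem HasBoundaryValues.exists_boundaryMap_eq {f g : L2HalfLine} {v : ℂ × ℂ}
    (h : Φ.HasBoundaryValues f g v.1 v.2) :
    ∃ hf : f ∈ (Lmax m).domain, Lmax m ⟨f, hf⟩ = g ∧ Φ.boundaryMap ⟨f, hf⟩ = v := by
  have hm : (f, g) ∈ (Lmax m).graph := by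
    rw [Lmax_graph]
    exact h.mem_maxGraph
  have hf := LinearPMap.mem_domain_of_mem_graph hm
  have hg : Lmax m ⟨f, hf⟩ = g := ((LinearPMap.image_iff hf).mpr hm).symm
  refine ⟨hf, hg, ?_⟩
  have h' := Φ.hasBoundaryValues_boundaryMap ⟨f, hf⟩
  rw [hg] at h'
  exact h'.eq h

theorem boundaryMap_surjective {ξ : ℝ → ℂ} (hξ : IsCutoff ξ) :
    Function.Surjective Φ.boundaryMap := by
  intro v
  obtain ⟨f, g, -, h⟩ := Φ.exists_cutoff_hasBoundaryValues hξ v.1 v.2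
  obtain ⟨hf, -, hv⟩ := h.exists_boundaryMap_eq
  exact ⟨⟨f, hf⟩, hv⟩

/-- The minimal domain consists of the elements of the maximal domain with vanishing boundary
values, because the boundary form is nondegenerate in the boundary values. -/
theorem mem_domain_Lmin_iff {ξ : ℝ → ℂ} (hξ : IsCutoff ξ) (f : (Lmax m).domain) :
    (f : L2HalfLine) ∈ (Lmin m).domain ↔ Φ.boundaryMap f = 0 := by
  have hf := Φ.hasBoundaryValues_boundaryMap f
  constructor
  · intro h
    have hgraph : ((f : L2HalfLine), Lmax m f) ∈ (Lmin m).graph := by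
      rw [LinearPMap.mem_graph_iff]
      exact ⟨⟨f, h⟩, rfl, (Lmin_le_Lmax m).2 rfl⟩
    have key : ∀ a b : ℂ, a * (Φ.boundaryMap f).2 - (Φ.boundaryMap f).1 * b = 0 := by
      intro a b
      obtain ⟨u, v, -, huv⟩ := Φ.exists_cutoff_hasBoundaryValues hξ a b
      rw [← hf.greenForm_eq huv]
      exact mem_graph_Lmin_iff.mp hgraph _ huv.mem_maxGraph
    exact Prod.ext (by simpa using key 0 1) (by simpa using key 1 0)
  · intro h
    rw [h] at hf
    refine LinearPMap.mem_domain_of_mem_graph (y := Lmax m f) (mem_graph_Lmin_iff.mpr ?_)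
    rintro ⟨u, v⟩ huv
    obtain ⟨a, b, hab⟩ := Φ.exists_hasBoundaryValues huv
    rw [hf.greenForm_eq hab]
    simp

/-- The restriction of the maximal operator to the functions with boundary values in `N`. -/
def restriction (N : Submodule ℂ (ℂ × ℂ)) : L2HalfLine →ₗ.[ℂ] L2HalfLine :=
  (Lmax m).domRestrict ((N.comap Φ.boundaryMap).map (Lmax m).domain.subtype)

theorem restriction_le (N : Submodule ℂ (ℂ × ℂ)) : Φ.restriction N ≤ Lmax m :=
  LinearPMap.domRestrict_le

theorem mem_domain_restriction_iff {N : Submodule ℂ (ℂ × ℂ)} (f : (Lmax m).domain) :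
    (f : L2HalfLine) ∈ (Φ.restriction N).domain ↔ Φ.boundaryMap f ∈ N := by
  constructor
  · rintro ⟨⟨f', hf', hff'⟩, -⟩
    obtain rfl : f' = f := Subtype.ext hff'
    exact hf'
  · exact fun h => ⟨⟨f, h, rfl⟩, f.2⟩

theorem eq_restriction {S : L2HalfLine →ₗ.[ℂ] L2HalfLine} {N : Submodule ℂ (ℂ × ℂ)}
    (hS : S ≤ Lmax m)
    (h : ∀ f : (Lmax m).domain, (f : L2HalfLine) ∈ S.domain ↔ Φ.boundaryMap f ∈ N) :
    S = Φ.restriction N := by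
  have hdom : S.domain = (Φ.restriction N).domain := by
    ext f
    constructor
    · intro hf
      exact (Φ.mem_domain_restriction_iff ⟨f, hS.1 hf⟩).mpr ((h ⟨f, hS.1 hf⟩).mp hf)
    · intro hf
      have hf' := (Φ.restriction_le N).1 hf
      exact (h ⟨f, hf'⟩).mpr ((Φ.mem_domain_restriction_iff ⟨f, hf'⟩).mp hf)
  refine LinearPMap.ext hdom fun f hf hf' => ?_
  rw [hS.2 (x := ⟨f, hf⟩) (y := ⟨f, hS.1 hf⟩) rfl,
    (Φ.restriction_le N).2 (x := ⟨f, hf'⟩) (y := ⟨f, hS.1 hf⟩) rfl]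

theorem restriction_bot {ξ : ℝ → ℂ} (hξ : IsCutoff ξ) : Φ.restriction ⊥ = Lmin m :=
  (Φ.eq_restriction (Lmin_le_Lmax m) fun f => by
    rw [Submodule.mem_bot]
    exact Φ.mem_domain_Lmin_iff hξ f).symm

theorem restriction_top : Φ.restriction ⊤ = Lmax m :=
  (Φ.eq_restriction le_rfl fun f => by simp).symm

theorem restriction_le_iff {ξ : ℝ → ℂ} (hξ : IsCutoff ξ) {N N' : Submodule ℂ (ℂ × ℂ)} :
    Φ.restriction N ≤ Φ.restriction N' ↔ N ≤ N' := by
  constructor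
  · intro h v hv
    obtain ⟨f, rfl⟩ := Φ.boundaryMap_surjective hξ v
    exact (Φ.mem_domain_restriction_iff f).mp (h.1 ((Φ.mem_domain_restriction_iff f).mpr hv))
  · intro h
    have hdom : ∀ f ∈ (Φ.restriction N).domain, f ∈ (Φ.restriction N').domain := fun f hf => by
      have hf' := (Φ.restriction_le N).1 hf
      exact (Φ.mem_domain_restriction_iff ⟨f, hf'⟩).mpr
        (h ((Φ.mem_domain_restriction_iff ⟨f, hf'⟩).mp hf))
    refine ⟨hdom, fun x y hxy => ?_⟩
    rw [(Φ.restriction_le N).2 (y := ⟨x, (Φ.restriction_le N).1 x.2⟩) rfl,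
      (Φ.restriction_le N').2 (y := ⟨x, (Φ.restriction_le N).1 x.2⟩) hxy.symm]

theorem restriction_lt_iff {ξ : ℝ → ℂ} (hξ : IsCutoff ξ) {N N' : Submodule ℂ (ℂ × ℂ)} :
    Φ.restriction N < Φ.restriction N' ↔ N < N' := by
  simp only [lt_iff_le_not_ge, Φ.restriction_le_iff hξ]

theorem restriction_injective {ξ : ℝ → ℂ} (hξ : IsCutoff ξ) :
    Function.Injective Φ.restriction := fun _ _ h =>
  le_antisymm ((Φ.restriction_le_iff hξ).mp h.le) ((Φ.restriction_le_iff hξ).mp h.ge)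

/-- Strict extensions of the minimal operator correspond to the lines in the two-dimensional
space of boundary values. -/
theorem isStrictExtension_iff {ξ : ℝ → ℂ} (hξ : IsCutoff ξ)
    {S : L2HalfLine →ₗ.[ℂ] L2HalfLine} :
    IsStrictExtension m S ↔
      ∃ N : Submodule ℂ (ℂ × ℂ), N ≠ ⊥ ∧ N ≠ ⊤ ∧ S = Φ.restriction N := by
  rw [IsStrictExtension, ← Φ.restriction_bot hξ, ← Φ.restriction_top]
  constructor
  · rintro ⟨h1, h2⟩
    rw [Φ.restriction_top] at h2
    have hS : S = Φ.restriction ((S.domain.comap (Lmax m).domain.subtype).map Φ.boundaryMap) := by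
      refine Φ.eq_restriction h2.le fun f => ⟨fun hf => ⟨f, hf, rfl⟩, ?_⟩
      rintro ⟨f', hf', hff'⟩
      have hk : ((f - f' : (Lmax m).domain) : L2HalfLine) ∈ (Φ.restriction ⊥).domain := by
        rw [mem_domain_restriction_iff, map_sub, hff', sub_self]
        exact Submodule.zero_mem _
      have hsum := S.domain.add_mem (h1.le.1 hk) hf'
      simpa using hsum
    rw [← Φ.restriction_top, hS, restriction_lt_iff Φ hξ] at h2
    rw [hS, restriction_lt_iff Φ hξ] at h1
    exact ⟨_, h1.ne', h2.ne, hS⟩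
  · rintro ⟨N, h1, h2, rfl⟩
    rw [restriction_lt_iff Φ hξ, restriction_lt_iff Φ hξ]
    exact ⟨bot_lt_iff_ne_bot.mpr h1, lt_top_iff_ne_top.mpr h2⟩

/-- The restriction to the boundary values in `N` is homogeneous if and only if `N` is invariant
under the action of dilations on boundary values. -/
theorem isHomogeneousOp_restriction_iff {ξ : ℝ → ℂ} (hξ : IsCutoff ξ)
    {l μ ν : ℝ → ℂ}
    (hp : ∀ τ, ∀ x > 0, Φ.p (Real.exp τ * x) = l τ * Φ.p x)
    (hq : ∀ τ, ∀ x > 0, Φ.q (Real.exp τ * x) = μ τ * Φ.q x + ν τ * Φ.p x)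
    (hlμ : ∀ τ, l τ * μ τ = (Real.exp τ : ℂ)) {N : Submodule ℂ (ℂ × ℂ)} :
    IsHomogeneousOp (-2) (Φ.restriction N) ↔
      ∀ τ, ∀ v ∈ N, (l τ * v.1 + ν τ * v.2, μ τ * v.2) ∈ N := by
  -- the action of the dilation by `τ` on an element of the maximal domain
  have key : ∀ (τ : ℝ) (f : (Lmax m).domain), ∃ hf : dilation τ f ∈ (Lmax m).domain,
      Lmax m ⟨dilation τ f, hf⟩ = ((Real.exp (2 * τ) : ℝ) : ℂ) • dilation τ (Lmax m f) ∧
      (dilation τ f ∈ (Φ.restriction N).domain ↔ (l τ * (Φ.boundaryMap f).1 +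
        ν τ * (Φ.boundaryMap f).2, μ τ * (Φ.boundaryMap f).2) ∈ N) := by
    intro τ f
    have h := (Φ.hasBoundaryValues_boundaryMap f).dilation (hp τ) (hq τ) (hlμ τ)
    obtain ⟨hf, h1, h2⟩ := HasBoundaryValues.exists_boundaryMap_eq (v := (_, _)) h
    refine ⟨hf, h1, ?_⟩
    rw [Φ.mem_domain_restriction_iff ⟨_, hf⟩, h2, ← smul_eq_mul (Complex.ofReal _),
      ← smul_eq_mul (Complex.ofReal _), ← Prod.smul_mk]
    exact N.smul_mem_iff (Complex.ofReal_ne_zero.mpr (Real.exp_ne_zero _))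
  constructor
  · intro h τ v hv
    obtain ⟨f, rfl⟩ := Φ.boundaryMap_surjective hξ v
    obtain ⟨hf, -, h2⟩ := key τ f
    obtain ⟨hd, -⟩ := h (-τ) ⟨f, (Φ.mem_domain_restriction_iff f).mpr hv⟩
    refine h2.mp ?_
    have e : dilation τ (f : L2HalfLine) = (dilation (-τ)).symm (f : L2HalfLine) := by
      change dilationFun τ f = dilationFun (-(-τ)) f
      rw [neg_neg]
    rw [e]
    exact hd
  · rintro h τ ⟨f, hf⟩
    have hf' := (Φ.restriction_le N).1 hf
    obtain ⟨hd, h1, h2⟩ := key (-τ) ⟨f, hf'⟩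
    have hmem := h2.mpr (h (-τ) _ ((Φ.mem_domain_restriction_iff ⟨f, hf'⟩).mp hf))
    refine ⟨hmem, ?_⟩
    have e1 : Φ.restriction N ⟨f, hf⟩ = Lmax m ⟨f, hf'⟩ := (Φ.restriction_le N).2 rfl
    have e2 : Φ.restriction N ⟨(dilation τ).symm f, hmem⟩ =
        ((Real.exp (2 * -τ) : ℝ) : ℂ) • (dilation τ).symm (Lmax m ⟨f, hf'⟩) :=
      ((Φ.restriction_le N).2 (y := ⟨dilation (-τ) f, hd⟩) rfl).trans h1
    rw [e1, e2, map_smul, LinearIsometryEquiv.apply_symm_apply, show 2 * -τ = -2 * τ by ring]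

end FundamentalSystem

/-! ### The fundamental systems made of powers and logarithms -/

theorem zetaFun_mul (m : ℂ) {x y : ℝ} (hx : 0 < x) (hy : 0 < y) :
    zetaFun m (x * y) = zetaFun m x * zetaFun m y := by
  rw [zetaFun, Complex.ofReal_mul, Complex.mul_cpow_ofReal_nonneg hx.le hy.le]
  rfl

theorem zetaFun_mul_zetaFun_neg (m : ℂ) {x : ℝ} (hx : 0 < x) :
    zetaFun m x * zetaFun (-m) x = x := by
  rw [zetaFun, zetaFun, ← Complex.cpow_add _ _ (Complex.ofReal_ne_zero.mpr hx.ne')]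
  ring_nf
  exact Complex.cpow_one _

theorem zetaFun_exp (m : ℂ) (τ : ℝ) : zetaFun m (Real.exp τ) = Complex.exp (τ * (1 / 2 + m)) := by
  rw [zetaFun, Complex.cpow_def_of_ne_zero (Complex.ofReal_ne_zero.mpr (Real.exp_ne_zero _)),
    ← Complex.ofReal_log (Real.exp_pos _).le, Real.log_exp]

/-- The derivative `(1/2 + m) x⁻¹ ζ_m(x)` of `ζ_m`. -/
def zetaDeriv (m : ℂ) (x : ℝ) : ℂ := (1 / 2 + m) * zetaFun m x / x

theorem hasDerivAt_zetaFun (m : ℂ) {x : ℝ} (hx : 0 < x) :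
    HasDerivAt (zetaFun m) (zetaDeriv m x) x := by
  have hx0 : (x : ℂ) ≠ 0 := Complex.ofReal_ne_zero.mpr hx.ne'
  have h := ((hasDerivAt_id (x : ℂ)).cpow_const (c := 1 / 2 + m)
    (Complex.ofReal_mem_slitPlane.mpr hx)).comp_ofReal
  refine h.congr_deriv ?_
  rw [zetaDeriv, zetaFun, id, Complex.cpow_sub _ _ hx0, Complex.cpow_one]
  ring

theorem hasDerivAt_zetaDeriv (m : ℂ) {x : ℝ} (hx : 0 < x) :
    HasDerivAt (zetaDeriv m) (potential m x * zetaFun m x) x := by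
  have hx0 : (x : ℂ) ≠ 0 := Complex.ofReal_ne_zero.mpr hx.ne'
  refine (((hasDerivAt_zetaFun m hx).const_mul (1 / 2 + m)).div
    ((hasDerivAt_id (x : ℂ)).comp_ofReal) hx0).congr_deriv ?_
  rw [zetaDeriv, potential, id]
  field_simp
  ring

theorem contDiffOn_zetaFun (m : ℂ) : ContDiffOn ℝ ∞ (zetaFun m) (Ioi 0) := by
  have hlog : ContDiffOn ℝ ∞ (fun x : ℝ => (Real.log x : ℂ)) (Ioi 0) :=
    Complex.ofRealCLM.contDiff.comp_contDiffOn
      (Real.contDiffOn_log.mono fun x hx => (ne_of_gt hx : x ≠ 0))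
  refine (Complex.contDiff_exp.comp_contDiffOn
    (hlog.mul (contDiffOn_const (c := 1 / 2 + m)))).congr fun x hx => ?_
  rw [zetaFun, Complex.cpow_def_of_ne_zero (Complex.ofReal_ne_zero.mpr (ne_of_gt hx)),
    ← Complex.ofReal_log (le_of_lt hx)]
  rfl

/-- `|ζ_m|² = x^{1 + 2 Re m}` is integrable near `0` for `Re m > -1`. -/
theorem memLp_zetaFun {m : ℂ} (hm : -1 < m.re) (R : ℝ) :
    MemLp (zetaFun m) 2 (volume.restrict (Ioc 0 R)) := by
  have hmeas : AEStronglyMeasurable (zetaFun m) (volume.restrict (Ioc 0 R)) :=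
    ((contDiffOn_zetaFun m).continuousOn.mono Ioc_subset_Ioi_self).aestronglyMeasurable
      measurableSet_Ioc
  rw [memLp_two_iff_integrable_sq_norm hmeas]
  have hi : IntegrableOn (fun x : ℝ => x ^ (1 + 2 * m.re)) (Ioc 0 R) :=
    (intervalIntegral.intervalIntegrable_rpow' (by linarith)).1
  refine hi.congr ?_
  filter_upwards [ae_restrict_mem measurableSet_Ioc] with x hx
  rw [zetaFun, Complex.norm_cpow_eq_rpow_re_of_pos hx.1, ← Real.rpow_natCast, ← Real.rpow_mul hx.1.le]
  congr 1
  simp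
  ring

namespace FundamentalSystem

/-- The fundamental system `ζ_m`, `-ζ_{-m} / (2m)` for `m ≠ 0`. -/
def ofNeZero (m : ℂ) (hm : |m.re| < 1) (h0 : m ≠ 0) : FundamentalSystem m where
  p := zetaFun m
  p' := zetaDeriv m
  q x := -(1 / (2 * m)) * zetaFun (-m) x
  q' x := -(1 / (2 * m)) * zetaDeriv (-m) x
  hasDerivAt_p _ hx := hasDerivAt_zetaFun m hx
  hasDerivAt_p' _ hx := hasDerivAt_zetaDeriv m hx
  hasDerivAt_q _ hx := (hasDerivAt_zetaFun (-m) hx).const_mul _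
  hasDerivAt_q' x hx := ((hasDerivAt_zetaDeriv (-m) hx).const_mul _).congr_deriv <| by
    rw [potential, potential, neg_sq]
    ring
  wronskian x hx := by
    have hx0 : (x : ℂ) ≠ 0 := Complex.ofReal_ne_zero.mpr (ne_of_gt hx)
    have h := zetaFun_mul_zetaFun_neg m hx
    rw [zetaDeriv, zetaDeriv]
    field_simp
    linear_combination (4 * m) * h
  memLp_p := memLp_zetaFun (abs_lt.mp hm).1
  memLp_q R := (memLp_zetaFun (by rw [Complex.neg_re]; linarith [(abs_lt.mp hm).2]) R).const_mul _
  contDiffOn_p := contDiffOn_zetaFun m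
  contDiffOn_q := contDiffOn_const.mul (contDiffOn_zetaFun (-m))

theorem _root_.memLp_zetaFun_zero_mul_log (R : ℝ) :
    MemLp (fun x : ℝ => zetaFun 0 x * (Real.log x : ℂ)) 2 (volume.restrict (Ioc 0 R)) := by
  -- `√x log x = -2 η(√x)` with `η(y) = -y log y`, which is continuous up to `0`
  have hc : Continuous fun x : ℝ => ((-2 * Real.negMulLog (Real.sqrt x) : ℝ) : ℂ) :=
    Complex.continuous_ofReal.comp
      (continuous_const.mul (Real.continuous_negMulLog.comp Real.continuous_sqrt))
  obtain ⟨C, hC⟩ := (isCompact_Icc (a := (0 : ℝ)) (b := R)).exists_bound_of_continuousOn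
    hc.continuousOn
  have hb : MemLp (fun x : ℝ => ((-2 * Real.negMulLog (Real.sqrt x) : ℝ) : ℂ)) 2
      (volume.restrict (Ioc 0 R)) := by
    refine MemLp.of_bound hc.aestronglyMeasurable C ?_
    filter_upwards [ae_restrict_mem measurableSet_Ioc] with x hx
    exact hC x (Ioc_subset_Icc_self hx)
  refine (memLp_congr_ae ?_).mp hb
  filter_upwards [ae_restrict_mem measurableSet_Ioc] with x hx
  have hz : zetaFun 0 x = (Real.sqrt x : ℂ) := by
    rw [zetaFun, Real.sqrt_eq_rpow, Complex.ofReal_cpow hx.1.le]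
    simp
  rw [hz, ← Complex.ofReal_mul, Real.negMulLog, Real.log_sqrt hx.1.le]
  congr 1
  ring

/-- The fundamental system `√x`, `√x log x` for `m = 0`. -/
def ofZero : FundamentalSystem 0 where
  p := zetaFun 0
  p' := zetaDeriv 0
  q x := zetaFun 0 x * (Real.log x : ℂ)
  q' x := zetaDeriv 0 x * (Real.log x : ℂ) + zetaFun 0 x * ((x⁻¹ : ℝ) : ℂ)
  hasDerivAt_p _ hx := hasDerivAt_zetaFun 0 hx
  hasDerivAt_p' _ hx := hasDerivAt_zetaDeriv 0 hx
  hasDerivAt_q _ hx :=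
    (hasDerivAt_zetaFun 0 hx).mul (Real.hasDerivAt_log (ne_of_gt hx)).ofReal_comp
  hasDerivAt_q' x hx := by
    have hx0 : (x : ℂ) ≠ 0 := Complex.ofReal_ne_zero.mpr (ne_of_gt hx)
    refine (((hasDerivAt_zetaDeriv 0 hx).mul (Real.hasDerivAt_log (ne_of_gt hx)).ofReal_comp).add
      ((hasDerivAt_zetaFun 0 hx).mul (hasDerivAt_inv (ne_of_gt hx)).ofReal_comp)).congr_deriv ?_
    rw [zetaDeriv, potential]
    push_cast
    field_simp
    ring
  wronskian x hx := by
    have hx0 : (x : ℂ) ≠ 0 := Complex.ofReal_ne_zero.mpr (ne_of_gt hx)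
    have h := zetaFun_mul_zetaFun_neg 0 hx
    rw [neg_zero] at h
    rw [zetaDeriv]
    push_cast
    field_simp
    linear_combination 2 * h
  memLp_p := memLp_zetaFun (by simp)
  memLp_q := memLp_zetaFun_zero_mul_log
  contDiffOn_p := contDiffOn_zetaFun 0
  contDiffOn_q := (contDiffOn_zetaFun 0).mul (Complex.ofRealCLM.contDiff.comp_contDiffOn
    (Real.contDiffOn_log.mono fun x hx => (ne_of_gt hx : x ≠ 0)))

/-! ### The operators `H_m` -/

theorem _root_.maxGraph_congr {m m' : ℂ} (h : m' ^ 2 = m ^ 2) : maxGraph m' = maxGraph m := by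
  have hL : formalL m' = formalL m := by
    funext φ x
    rw [formalL, formalL, h]
  ext p
  change IsDistribL m' p.1 p.2 ↔ IsDistribL m p.1 p.2
  rw [IsDistribL, IsDistribL, hL]

/-- If `ζ_{m'} = a p + b q`, then `H_{m'}` is the restriction of the maximal operator to the line
of boundary values spanned by `(a, b)`. -/
theorem Hop_eq_restriction {m m' : ℂ} (Φ : FundamentalSystem m) {ξ : ℝ → ℂ} (hξ : IsCutoff ξ)
    (hm : m' ^ 2 = m ^ 2) {v : ℂ × ℂ}
    (hv : ∀ x > 0, zetaFun m' x = v.1 * Φ.p x + v.2 * Φ.q x) :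
    Hop ξ m' = Φ.restriction (Submodule.span ℂ {v}) := by
  have hmax : Lmax m' = Lmax m := by rw [Lmax, Lmax, maxGraph_congr hm]
  have hmin : Lmin m' = Lmin m := by rw [Lmin, Lmin, hmax]
  obtain ⟨u, g, hu, h⟩ := Φ.exists_cutoff_hasBoundaryValues hξ v.1 v.2
  obtain ⟨hud, -, huv⟩ := h.exists_boundaryMap_eq
  have hu' : u =ᵐ[halfLineMeasure] fun x => ξ x * zetaFun m' x := by
    filter_upwards [hu, ae_restrict_mem measurableSet_Ioi] with x hx hx0
    rw [hx, hv x hx0]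
  have hline : cutoffLine ξ m' = Submodule.span ℂ {u} := by
    ext f
    rw [Submodule.mem_span_singleton]
    refine exists_congr fun c => ⟨fun hf => Lp.ext ?_, ?_⟩
    · filter_upwards [hf, hu', Lp.coeFn_smul c u] with x h1 h2 h3
      rw [h1, h3, Pi.smul_apply, h2, smul_eq_mul]
    · rintro rfl
      filter_upwards [hu', Lp.coeFn_smul c u] with x h2 h3
      rw [h3, Pi.smul_apply, h2, smul_eq_mul]
  rw [Hop, hmax, hmin, hline]
  refine Φ.eq_restriction LinearPMap.domRestrict_le fun f => ?_
  have hmem : (f : L2HalfLine) ∈ ((Lmax m).domRestrict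
      ((Lmin m).domain ⊔ Submodule.span ℂ {u})).domain ↔
      (f : L2HalfLine) ∈ (Lmin m).domain ⊔ Submodule.span ℂ {u} :=
    ⟨fun hf => hf.1, fun hf => ⟨hf, f.2⟩⟩
  rw [hmem, Submodule.mem_sup, Submodule.mem_span_singleton]
  constructor
  · rintro ⟨f₀, hf₀, y, hy, hsum⟩
    obtain ⟨c, rfl⟩ := Submodule.mem_span_singleton.mp hy
    have hf₀' := (Lmin_le_Lmax m).1 hf₀
    have h0 := (Φ.mem_domain_Lmin_iff hξ ⟨f₀, hf₀'⟩).mp hf₀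
    have e : f = (⟨f₀, hf₀'⟩ : (Lmax m).domain) + c • ⟨u, hud⟩ := Subtype.ext hsum.symm
    exact ⟨c, by rw [e, map_add, map_smul, h0, huv, zero_add]⟩
  · rintro ⟨c, hc⟩
    refine ⟨(f - c • ⟨u, hud⟩ : (Lmax m).domain), ?_, c • u,
      Submodule.smul_mem _ _ (Submodule.mem_span_singleton_self u), by simp⟩
    rw [Φ.mem_domain_Lmin_iff hξ, map_sub, map_smul, huv, hc, sub_self]

end FundamentalSystem

/-! ### Lines in the space of boundary values -/

theorem eq_span_singleton_of_mem {N : Submodule ℂ (ℂ × ℂ)} (hN : N ≠ ⊤) {v : ℂ × ℂ} (hv : v ≠ 0)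
    (hvN : v ∈ N) : N = Submodule.span ℂ {v} := by
  have h1 := finrank_span_singleton (K := ℂ) hv
  have h2 := Submodule.finrank_lt hN
  have h3 : Module.finrank ℂ (ℂ × ℂ) = 2 := by simp
  exact (Submodule.eq_of_le_of_finrank_le ((Submodule.span_singleton_le_iff_mem v N).mpr hvN)
    (by omega)).symm

theorem span_singleton_ne_top (v : ℂ × ℂ) : Submodule.span ℂ {v} ≠ ⊤ := by
  intro h
  have h1 := finrank_span_le_card (R := ℂ) ({v} : Set (ℂ × ℂ))
  rw [h, finrank_top] at h1
  simp at h1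

/-- The two eigenvalues of a dilation on the boundary values are different for a suitable
dilation. -/
theorem exists_zetaFun_exp_ne {m : ℂ} (hm : m ≠ 0) :
    ∃ τ : ℝ, zetaFun m (Real.exp τ) ≠ zetaFun (-m) (Real.exp τ) := by
  refine ⟨‖m‖⁻¹, fun h => ?_⟩
  rw [zetaFun_exp, zetaFun_exp, Complex.exp_eq_exp_iff_exists_int] at h
  obtain ⟨n, hn⟩ := h
  have hm' : ‖m‖ ≠ 0 := norm_ne_zero_iff.mpr hm
  -- the exponents differ by a number of modulus `2`, which is not a multiple of `2 π`
  have e : 2 * ((‖m‖⁻¹ : ℝ) : ℂ) * m = n * (2 * Real.pi * Complex.I) := by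
    linear_combination hn
  have e' := congrArg norm e
  simp only [norm_mul, Complex.norm_I, Complex.norm_real, Complex.norm_intCast, norm_norm, mul_one,
    Complex.norm_ofNat, norm_inv] at e'
  rw [mul_assoc, inv_mul_cancel₀ hm', mul_one, Real.norm_of_nonneg Real.pi_pos.le] at e'
  rcases eq_or_ne n 0 with rfl | h0
  · simp at e'
  · have h1 : (1 : ℝ) ≤ |(n : ℝ)| := by exact_mod_cast Int.one_le_abs h0
    nlinarith [Real.pi_gt_three]

/-! ### Homogeneous strict extensions -/

/-- Homogeneous strict extensions correspond to the lines of boundary values that are invariant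
under the dilations. -/
theorem FundamentalSystem.strict_and_homogeneous_iff {m : ℂ} (Φ : FundamentalSystem m) {ξ : ℝ → ℂ}
    (hξ : IsCutoff ξ) {l μ ν : ℝ → ℂ}
    (hp : ∀ τ, ∀ x > 0, Φ.p (Real.exp τ * x) = l τ * Φ.p x)
    (hq : ∀ τ, ∀ x > 0, Φ.q (Real.exp τ * x) = μ τ * Φ.q x + ν τ * Φ.p x)
    (hlμ : ∀ τ, l τ * μ τ = (Real.exp τ : ℂ)) {S : L2HalfLine →ₗ.[ℂ] L2HalfLine} :
    IsStrictExtension m S ∧ IsHomogeneousOp (-2) S ↔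
      ∃ v : ℂ × ℂ, v ≠ 0 ∧ S = Φ.restriction (Submodule.span ℂ {v}) ∧
        ∀ τ, ∃ c : ℂ, c • v = (l τ * v.1 + ν τ * v.2, μ τ * v.2) := by
  rw [Φ.isStrictExtension_iff hξ]
  constructor
  · rintro ⟨⟨N, hbot, htop, rfl⟩, hhom⟩
    rw [Φ.isHomogeneousOp_restriction_iff hξ hp hq hlμ] at hhom
    obtain ⟨v, hvN, hv⟩ := N.ne_bot_iff.mp hbot
    have hN := eq_span_singleton_of_mem htop hv hvN
    refine ⟨v, hv, by rw [← hN], fun τ => ?_⟩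
    have h := hhom τ v hvN
    rw [hN] at h
    exact Submodule.mem_span_singleton.mp h
  · rintro ⟨v, hv, rfl, hinv⟩
    refine ⟨⟨_, ?_, span_singleton_ne_top v, rfl⟩, ?_⟩
    · rwa [Ne, Submodule.span_singleton_eq_bot]
    · rw [Φ.isHomogeneousOp_restriction_iff hξ hp hq hlμ]
      intro τ w hw
      obtain ⟨k, rfl⟩ := Submodule.mem_span_singleton.mp hw
      obtain ⟨c, hc⟩ := hinv τ
      have e : (l τ * (k • v).1 + ν τ * (k • v).2, μ τ * (k • v).2) = k • c • v := by
        rw [hc]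
        refine Prod.ext ?_ ?_ <;> simp only [Prod.smul_fst, Prod.smul_snd, smul_eq_mul] <;> ring
      rw [e]
      exact Submodule.smul_mem _ _ (Submodule.smul_mem _ _ (Submodule.mem_span_singleton_self v))

/-- For `m ≠ 0` the dilations act on the boundary values diagonally with different eigenvalues, so
exactly the two coordinate axes are invariant. -/
theorem homogeneous_strict_extensions_of_ne_zero {ξ : ℝ → ℂ} (hξ : IsCutoff ξ) {m : ℂ}
    (hm : |m.re| < 1) (h0 : m ≠ 0) :
    Hop ξ m ≠ Hop ξ (-m) ∧
      {S : L2HalfLine →ₗ.[ℂ] L2HalfLine | IsStrictExtension m S ∧ IsHomogeneousOp (-2) S} =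
        {Hop ξ m, Hop ξ (-m)} := by
  set Φ := FundamentalSystem.ofNeZero m hm h0 with hΦ
  have hH1 : Hop ξ m = Φ.restriction (Submodule.span ℂ {((1 : ℂ), (0 : ℂ))}) :=
    Φ.Hop_eq_restriction hξ rfl fun x _ => by
      simp [hΦ, FundamentalSystem.ofNeZero]
  have hH2 : Hop ξ (-m) = Φ.restriction (Submodule.span ℂ {((0 : ℂ), -(2 * m))}) :=
    Φ.Hop_eq_restriction hξ (neg_sq m) fun x _ => by
      simp only [hΦ, FundamentalSystem.ofNeZero]
      field_simp
      ring
  have hp : ∀ τ, ∀ x > 0, Φ.p (Real.exp τ * x) = zetaFun m (Real.exp τ) * Φ.p x :=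
    fun τ x hx => zetaFun_mul m (Real.exp_pos τ) hx
  have hq : ∀ τ, ∀ x > 0, Φ.q (Real.exp τ * x) =
      zetaFun (-m) (Real.exp τ) * Φ.q x + (fun _ => 0) τ * Φ.p x := fun τ x hx => by
    simp only [hΦ, FundamentalSystem.ofNeZero]
    rw [zetaFun_mul (-m) (Real.exp_pos τ) hx]
    ring
  constructor
  · rw [hH1, hH2]
    intro h
    have hspan := Φ.restriction_injective hξ h
    have hmem : ((1 : ℂ), (0 : ℂ)) ∈ Submodule.span ℂ {((0 : ℂ), -(2 * m))} := by
      rw [← hspan]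
      exact Submodule.mem_span_singleton_self _
    obtain ⟨c, hc⟩ := Submodule.mem_span_singleton.mp hmem
    simpa using congrArg Prod.fst hc
  · ext S
    rw [mem_ofPred_eq, Φ.strict_and_homogeneous_iff hξ (ν := fun _ => 0) hp hq
      (fun τ => zetaFun_mul_zetaFun_neg m (Real.exp_pos τ)), mem_insert_iff, mem_singleton_iff,
      hH1, hH2]
    constructor
    · rintro ⟨⟨v₁, v₂⟩, hv, rfl, hinv⟩
      obtain ⟨τ, hτ⟩ := exists_zetaFun_exp_ne h0
      obtain ⟨c, hc⟩ := hinv τ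
      have e1 : c * v₁ = zetaFun m (Real.exp τ) * v₁ := by simpa using congrArg Prod.fst hc
      have e2 : c * v₂ = zetaFun (-m) (Real.exp τ) * v₂ := by simpa using congrArg Prod.snd hc
      have hne : ∀ v : ℂ × ℂ, v ≠ 0 → v ∈ Submodule.span ℂ {(v₁, v₂)} →
          Submodule.span ℂ {(v₁, v₂)} = Submodule.span ℂ {v} := fun v h h' =>
        eq_span_singleton_of_mem (span_singleton_ne_top _) h h'
      rcases eq_or_ne v₂ 0 with rfl | h2
      · have h1 : v₁ ≠ 0 := fun h => hv (by rw [h]; rfl)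
        left
        rw [hne (1, 0) (by simp) (Submodule.mem_span_singleton.mpr ⟨v₁⁻¹, by simp [h1]⟩)]
      · have h1 : v₁ = 0 := by
          by_contra h1
          exact hτ ((mul_right_cancel₀ h1 e1).symm.trans (mul_right_cancel₀ h2 e2))
        right
        rw [hne (0, -(2 * m)) (by simp [h0])
          (Submodule.mem_span_singleton.mpr ⟨-(2 * m) * v₂⁻¹, by simp [h1, h2]⟩)]
    · rintro (rfl | rfl)
      · exact ⟨_, by simp, rfl, fun τ => ⟨zetaFun m (Real.exp τ), by simp⟩⟩
      · exact ⟨_, by simp [h0], rfl, fun τ => ⟨zetaFun (-m) (Real.exp τ), by simp⟩⟩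

/-- For `m = 0` the dilations act on the boundary values by Jordan blocks, so the line spanned by
`(1, 0)` is the only invariant one. -/
theorem homogeneous_strict_extensions_of_zero {ξ : ℝ → ℂ} (hξ : IsCutoff ξ) :
    {S : L2HalfLine →ₗ.[ℂ] L2HalfLine | IsStrictExtension 0 S ∧ IsHomogeneousOp (-2) S} =
      {Hop ξ 0} := by
  set Φ := FundamentalSystem.ofZero with hΦ
  have hH : Hop ξ 0 = Φ.restriction (Submodule.span ℂ {((1 : ℂ), (0 : ℂ))}) :=
    Φ.Hop_eq_restriction hξ rfl fun x _ => by simp [hΦ, FundamentalSystem.ofZero]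
  have hp : ∀ τ, ∀ x > 0, Φ.p (Real.exp τ * x) = zetaFun 0 (Real.exp τ) * Φ.p x :=
    fun τ x hx => zetaFun_mul 0 (Real.exp_pos τ) hx
  have hq : ∀ τ, ∀ x > 0, Φ.q (Real.exp τ * x) = zetaFun 0 (Real.exp τ) * Φ.q x +
      (fun τ : ℝ => τ * zetaFun 0 (Real.exp τ)) τ * Φ.p x := fun τ x hx => by
    simp only [hΦ, FundamentalSystem.ofZero]
    rw [zetaFun_mul 0 (Real.exp_pos τ) hx, Real.log_mul (Real.exp_ne_zero τ) (ne_of_gt hx),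
      Real.log_exp]
    push_cast
    ring
  have hlμ : ∀ τ, zetaFun 0 (Real.exp τ) * zetaFun 0 (Real.exp τ) = (Real.exp τ : ℂ) := fun τ => by
    simpa using zetaFun_mul_zetaFun_neg 0 (Real.exp_pos τ)
  ext S
  rw [mem_ofPred_eq, Φ.strict_and_homogeneous_iff hξ
    (ν := fun τ : ℝ => τ * zetaFun 0 (Real.exp τ)) hp hq hlμ, mem_singleton_iff, hH]
  constructor
  · rintro ⟨⟨v₁, v₂⟩, hv, rfl, hinv⟩
    obtain ⟨c, hc⟩ := hinv 1
    have e1 : c * v₁ = zetaFun 0 (Real.exp 1) * v₁ + zetaFun 0 (Real.exp 1) * v₂ := by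
      simpa using congrArg Prod.fst hc
    have e2 : c * v₂ = zetaFun 0 (Real.exp 1) * v₂ := by simpa using congrArg Prod.snd hc
    have h2 : v₂ = 0 := by
      by_contra h2
      rw [mul_right_cancel₀ h2 e2, left_eq_add, mul_eq_zero] at e1
      refine e1.elim (fun h => ?_) h2
      rw [zetaFun_exp] at h
      exact Complex.exp_ne_zero _ h
    subst h2
    have h1 : v₁ ≠ 0 := fun h => hv (by rw [h]; rfl)
    rw [eq_span_singleton_of_mem (span_singleton_ne_top _) (v := (1, 0)) (by simp)
      (Submodule.mem_span_singleton.mpr ⟨v₁⁻¹, by simp [h1]⟩)]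
  · rintro rfl
    exact ⟨_, by simp, rfl, fun τ => ⟨zetaFun 0 (Real.exp τ), by simp⟩⟩

end
theorem mainTheorem5 (ξ : ℝ → ℂ) (hξ : IsCutoff ξ) :
    (∀ m : ℂ, |m.re| < 1 → m ≠ 0 →
      Hop ξ m ≠ Hop ξ (-m) ∧
      {S : L2HalfLine →ₗ.[ℂ] L2HalfLine | IsStrictExtension m S ∧ IsHomogeneousOp (-2) S} =
        {Hop ξ m, Hop ξ (-m)}) ∧
    {S : L2HalfLine →ₗ.[ℂ] L2HalfLine | IsStrictExtension 0 S ∧ IsHomogeneousOp (-2) S} =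
      {Hop ξ 0} :=
  ⟨fun _ hm h0 => homogeneous_strict_extensions_of_ne_zero hξ hm h0,
    homogeneous_strict_extensions_of_zero hξ⟩
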